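/- Let $I=\mathbb{Z}_+$ or $I=\mathbb{R}_+$, and let $(X_t)_{t\in I}$ be a time-homogeneous Markov process with values in a measurable space $(E,\mathcal{E})$ that also carries a topology. Let $(\mathbb{P}_x)_{x\in E}$ be its family of laws (so $\mathbb{P}_x(X_0=x)=1$), put $\mathbb{P}_\mu=\int\mathbb{P}_x\,\mu(dx)$, and let $\mathcal{F}_t=\sigma(X_v,\ v\le t)$. Assume that the set of trajectories is stable under time shifts. Let $(A_t)_{t\in I}$ be a family of measurable subsets of $E$ that is non-increasing in $t$ and has $A_\infty:=\bigcap_{t\in I}A_t\neq\emptyset$. Put $E_t=E\setminus A_t$ and $E_\infty=E\setminus A_\infty$. For $s\in I$ let $$\tau_{A\circ\theta_s}=\inf\{t\in I: X_t\in A_{s+t}\},\qquad \tau_{A_\infty}=\inf\{t\in I: X_t\in A_\infty\}.$$ Each of these times $\tau$ is assumed to be an optional time, that is, $\{\tau<t\}\in\mathcal{F}_t$ for all $t\in I$. (This is automatic if $I=\mathbb{Z}_+$.) Assume that for all $s,t\in I$ and $x\in E_s$, $$\mathbb{P}_x(\tau_{A\circ\theta_s}<\infty)=1\quad\text{and}\quad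 \mathbb{P}_x(\tau_{A\circ\theta_s}>t)>0 .$$ Assume moreover the following. (a) (Strong Markov property.) For every stopping time $\tau$ of $(\mathcal{F}_t)_{t\in I}$, the variable $X_\tau$ is $\mathcal{F}_\tau$-measurable on $\{\tau<\infty\}$, and for every $x\in E$, $$\mathbb{P}_x\big((X_{\tau+t})_{t\in I}\in\cdot,\ \tau<\infty\,\big|\,\mathcal{F}_\tau\big)=\mathbf{1}_{\tau<\infty}\,\mathbb{P}_{X_\tau}\big((X_t)_{t\in I}\in\cdot\big).$$ (b) For every $x\in E_0$, $\tau_{A\circ\theta_s}$ converges in law to $\tau_{A_\infty}$ under $\mathbb{P}_x$ as $s\to\infty$ (as $[0,\infty]$-valued random variables). (c) For every $x\in E_0$ and $s\in I$, the functions $t\mapsto\mathbb{P}_x(\tau_{A\circ\theta_s}>t)$ and $t\mapsto\mathbb{P}_x(\tau_{A_\infty}>t)$ are continuous on $I$. (d) For every $t\in I$, the function $x\mapsto\mathbb{P}_x(\tau_{A_\infty}>t)$ is continuous on $E$. (e) There exist a probability measure $\nu_\infty$ on $E$ with $\nu_\infty(A_\infty)=0$, a time $t_\infty\in I$ and constants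 $c_{1,\infty},c_{2,\infty}>0$ such that for all $x\in E_\infty$ and $t\in I$, $$\mathbb{P}_x(X_{t_\infty}\in\cdot\mid\tau_{A_\infty}>t_\infty)\ \ge\ c_{1,\infty}\,\nu_\infty,\qquad \mathbb{P}_{\nu_\infty}(\tau_{A_\infty}>t)\ \ge\ c_{2,\infty}\,\mathbb{P}_x(\tau_{A_\infty}>t).$$ Then for every $x\in E_0$, $$\lim_{s\to\infty}\ \sup_{t,T\in I}\ \big\|\mathbb{P}_x(X_t\in\cdot\mid\tau_{A\circ\theta_s}>t+T)-\mathbb{P}_x(X_t\in\cdot\mid\tau_{A_\infty}>t+T)\big\|_{TV}=0,$$ where $\|\mu-\nu\|_{TV}=\sup_{B\in\mathcal{E}}|\mu(B)-\nu(B)|$. -/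

import Mathlib

open MeasureTheory ProbabilityTheory Filter Topology
open scoped NNReal ENNReal ProbabilityTheory

namespace MovingBoundary

/-- The set of times is either the nonnegative integers or the nonnegative reals. -/
def IsTimeSet (I : AddSubmonoid ℝ≥0) : Prop :=
  I = AddMonoidHom.mrange (Nat.castAddMonoidHom ℝ≥0) ∨ I = ⊤

/-- A time-homogeneous Markov process `(X_t)_{t ∈ I}` with values in the measurable space `E`,
defined on `Ω`, with its family of laws `(P_x)_{x ∈ E}`. -/
structure MarkovFamily (I : AddSubmonoid ℝ≥0) (E : Type*) [MeasurableSpace E]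
    (Ω : Type*) [MeasurableSpace Ω] where
  /-- the process -/
  X : I → Ω → E
  /-- the laws `P_x` -/
  P : Kernel E Ω
  measurable_X : ∀ t, Measurable (X t)
  isMarkovKernel_P : IsMarkovKernel P
  /-- the process starts from `x` under `P_x` -/
  start : ∀ x, ∀ᵐ ω ∂(P x), X 0 ω = x
  /-- the set of trajectories is stable under the time shifts -/
  shift : ∀ (u : I) (ω : Ω), ∃ ω' : Ω, ∀ t, X t ω' = X (u + t) ω
  /-- the Markov property: `P_x((X_{u+t})_t ∈ C | σ(X_v, v ≤ u)) = P_{X_u}((X_t)_t ∈ C)` -/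
  markov : ∀ (u : I) (x : E) (C : Set (I → E)), MeasurableSet C →
    ∀ G : Set Ω, MeasurableSet[⨆ v ≤ u, MeasurableSpace.comap (X v) inferInstance] G →
      P x (G ∩ {ω | (fun t => X (u + t) ω) ∈ C}) =
        ∫⁻ ω in G, P (X u ω) {ω' | (fun t => X t ω') ∈ C} ∂(P x)

namespace MarkovFamily

variable {I : AddSubmonoid ℝ≥0} {E : Type*} [MeasurableSpace E] {Ω : Type*} [MeasurableSpace Ω]

instance (M : MarkovFamily I E Ω) : IsMarkovKernel M.P := M.isMarkovKernel_P

/-- The natural filtration `F_t = σ(X_v, v ≤ t)`. -/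
def filtration (M : MarkovFamily I E Ω) : Filtration I (inferInstance : MeasurableSpace Ω) where
  seq t := ⨆ v ≤ t, MeasurableSpace.comap (M.X v) inferInstance
  mono' _ _ h := biSup_mono fun _ hv => hv.trans h
  le' _ := iSup₂_le fun v _ => (M.measurable_X v).comap_le

/-- The hitting time `inf {t ∈ I : X_t ∈ B_t}` of a moving set `B`, with values in `[0, ∞]`. -/
noncomputable def hit (M : MarkovFamily I E Ω) (B : I → Set E) (ω : Ω) : ℝ≥0∞ :=
  sInf ((fun t : I => ((t : ℝ≥0) : ℝ≥0∞)) '' {t | M.X t ω ∈ B t})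

/-- The event `{τ_B > t}`. -/
def survive (M : MarkovFamily I E Ω) (B : I → Set E) (t : I) : Set Ω :=
  {ω | ((t : ℝ≥0) : ℝ≥0∞) < M.hit B ω}

/-- The conditioned law `P_x(X_t ∈ · | τ_B > u)`. -/
noncomputable def condLaw (M : MarkovFamily I E Ω) (B : I → Set E) (x : E) (t u : I) :
    Measure E :=
  ((M.P x)[|M.survive B u]).map (M.X t)

/-- The strong Markov property: for every stopping time `τ` of the natural filtration, `X_τ` is
`F_τ`-measurable on `{τ < ∞}`, and for every `x`
`P_x((X_{τ+t})_t ∈ ·, τ < ∞ | F_τ) = 1_{τ < ∞} P_{X_τ}((X_t)_t ∈ ·)`. -/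
def StrongMarkov (M : MarkovFamily I E Ω) : Prop :=
  ∀ (τ : Ω → WithTop I) (hτ : IsStoppingTime M.filtration τ),
    (∀ B : Set E, MeasurableSet B →
      MeasurableSet[hτ.measurableSpace] {ω | τ ω ≠ ⊤ ∧ M.X ((τ ω).untopD 0) ω ∈ B}) ∧
    ∀ (x : E) (C : Set (I → E)), MeasurableSet C →
      ∀ G : Set Ω, MeasurableSet[hτ.measurableSpace] G →
        M.P x (G ∩ {ω | τ ω ≠ ⊤ ∧ (fun t => M.X ((τ ω).untopD 0 + t) ω) ∈ C}) =
          ∫⁻ ω in G ∩ {ω | τ ω ≠ ⊤},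
            M.P (M.X ((τ ω).untopD 0) ω) {ω' | (fun t => M.X t ω') ∈ C} ∂(M.P x)

end MarkovFamily

variable {I : AddSubmonoid ℝ≥0} {E : Type*} [MeasurableSpace E] {Ω : Type*} [MeasurableSpace Ω]

/-- The shifted boundary `A ∘ θ_s : t ↦ A_{s+t}`. -/
def shifted (A : I → Set E) (s : I) : I → Set E := fun t => A (s + t)

/-- The limit `A_∞ = ⋂ t, A_t`. -/
def limitSet (A : I → Set E) : Set E := ⋂ t, A t

/-- The non-moving boundary `A_∞`. -/
def limitBoundary (A : I → Set E) : I → Set E := fun _ => limitSet A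

/-- The standing assumptions on the moving boundary `(A_t)_{t ∈ I}`. -/
structure Standing (M : MarkovFamily I E Ω) (A : I → Set E) : Prop where
  measurableSet : ∀ t, MeasurableSet (A t)
  /-- `A` is non-increasing -/
  antitone : Antitone A
  /-- `A` converges -/
  nonempty_limit : (limitSet A).Nonempty
  /-- the hitting times are optional times: `{τ < t} ∈ F_t`; this is automatic in discrete time,
  and every stopping time of the natural filtration has this property -/
  optional_shifted : ∀ s t : I,
    MeasurableSet[M.filtration t] {ω | M.hit (shifted A s) ω < ((t : ℝ≥0) : ℝ≥0∞)}
  optional_limit : ∀ t : I,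
    MeasurableSet[M.filtration t] {ω | M.hit (limitBoundary A) ω < ((t : ℝ≥0) : ℝ≥0∞)}
  /-- almost sure absorption from `E_s` -/
  finite_hit : ∀ s : I, ∀ x ∉ A s, M.P x {ω | M.hit (shifted A s) ω < ∞} = 1
  /-- the conditionings make sense -/
  survive_pos : ∀ s t : I, ∀ x ∉ A s, 0 < M.P x (M.survive (shifted A s) t)

/-- Strong Markov property, convergence of the hitting times, continuity in time and in space. -/
structure Regularity [TopologicalSpace E] (M : MarkovFamily I E Ω) (A : I → Set E) : Prop where
  strongMarkov : M.StrongMarkov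
  /-- for `x ∈ E_0`, the hitting time of `A ∘ θ_s` converges in law to that of `A_∞` -/
  tendsto_hit : ∀ x ∉ A 0,
    TendstoInDistribution (fun s : I => M.hit (shifted A s)) atTop (M.hit (limitBoundary A))
      (fun _ => M.P x) (M.P x)
  continuous_time : ∀ x ∉ A 0, ∀ s : I,
    Continuous fun t : I => (M.P x).real (M.survive (shifted A s) t)
  continuous_time_limit : ∀ x ∉ A 0,
    Continuous fun t : I => (M.P x).real (M.survive (limitBoundary A) t)
  continuous_state : ∀ t : I, Continuous fun x : E => (M.P x).real (M.survive (limitBoundary A) t)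

/-- The Champagnat-Villemonais conditions for the process absorbed at `A_∞`. -/
def LimitCV (M : MarkovFamily I E Ω) (A : I → Set E) : Prop :=
  ∃ ν : Measure E, IsProbabilityMeasure ν ∧ ν (limitSet A) = 0 ∧
    (∃ (t₀ : I) (c₁ : ℝ≥0), 0 < c₁ ∧
      ∀ x ∉ limitSet A, c₁ • ν ≤ M.condLaw (limitBoundary A) x t₀ t₀) ∧
    ∃ c₂ : ℝ≥0, 0 < c₂ ∧ ∀ x ∉ limitSet A, ∀ t : I,
      (c₂ : ℝ≥0∞) * M.P x (M.survive (limitBoundary A) t) ≤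
        (M.P ∘ₘ ν) (M.survive (limitBoundary A) t)

/-- The total variation distance `sup_B |μ(B) - ν(B)|` of two probability measures, as an
element of `[0, ∞]`. -/
noncomputable def tvDist (μ ν : Measure E) : ℝ≥0∞ :=
  ⨆ (B : Set E) (_ : MeasurableSet B), ENNReal.ofReal |μ.real B - ν.real B|

end MovingBoundary

namespace MovingBoundary

/-! Let `Q r f` and `R s r f` be the expectations of `f(X_r)` killed at `A_∞` and at `A ∘ θ_s`, and
let `q_r = Q r 1`. By the Markov property both conditioned laws are quotients, such as `Q_t(b q_T) /
q_{t+T}` for the limit. The theorem thus compares two positive semigroups `R ≤ Q` at the point `x`,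
which is the setting of `KilledPair`.

Condition (e) yields a contraction: over a time `n • t₁` the oscillation of `Q f / Q 1` shrinks by
`ρ ^ n` (`exists_ratio`). On the other hand `R s` approaches `Q` only on bounded time intervals,
while `t` and `T` are arbitrary. The horizon is therefore cut into a past, a window of bounded
length around `t`, and a future. In the window `R` is replaced by `Q` at a small relative cost
(`eventually_loss`). Then the future is forgotten, because `Q_w g` is almost proportional to `q_w`
(`exists_comparable`), and so is the past, because `Q_d(b q_w) / Q_d q_w` is almost constant.
`eventually_abs_sub_le` adds the errors.

Two bounds must be uniform in the unbounded past and future. First, the process conditioned up to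
the window must not sit where the moving boundary kills quickly. `eventually_mass` shows this by
induction along a time grid: a moderate relative loss in one window lets `loss_le` compare the next
loss with the loss seen from `ν`, which is small. Second, the terminal function `g` coming from the
future must satisfy `g ≤ L ν(g)` with `L` independent of the horizon. This is `exists_harnack`, an
induction that reproduces its own constant.

Killing is recorded by `{τ ≥ t}` instead of `{τ > t}`, since the former lies in `F_t` for an
optional time. The discrepancy is removed by continuity in time, or by a unit shift in discrete
time. -/

/-- The algebra of bounded measurable real functions. -/
def boundedMeasurable (E : Type*) [MeasurableSpace E] : Subalgebra ℝ (E → ℝ) where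
  carrier := {f | Measurable f ∧ ∃ K, ∀ y, |f y| ≤ K}
  mul_mem' := by
    rintro f g ⟨hf, a, ha⟩ ⟨hg, b, hb⟩
    refine ⟨hf.mul hg, a * b, fun y => ?_⟩
    rw [Pi.mul_apply, abs_mul]
    exact mul_le_mul (ha y) (hb y) (abs_nonneg _) ((abs_nonneg _).trans (ha y))
  add_mem' := by
    rintro f g ⟨hf, a, ha⟩ ⟨hg, b, hb⟩
    exact ⟨hf.add hg, a + b, fun y => (abs_add_le _ _).trans (add_le_add (ha y) (hb y))⟩
  algebraMap_mem' r := ⟨measurable_const, |r|, fun _ => le_rfl⟩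

/-- A time-homogeneous semigroup `Q` and a time-inhomogeneous semigroup `R ≤ Q` of positive
operators on bounded measurable functions, such that `Q` satisfies a Doeblin-type minorization
with respect to `ν`, and such that the masses of `R s` converge to those of `Q` at the point `x`,
locally uniformly in time, as `s → ∞`. -/
structure KilledPair (I : AddSubmonoid ℝ≥0) (E : Type*) [MeasurableSpace E] where
  Q : I → boundedMeasurable E →ₗ[ℝ] boundedMeasurable E
  R : I → I → boundedMeasurable E →ₗ[ℝ] boundedMeasurable E
  ν : boundedMeasurable E →ₗ[ℝ] ℝ
  x : E
  t₁ : I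
  c : ℝ
  K : ℝ
  R_nonneg : ∀ s r f, (∀ y, 0 ≤ f.1 y) → ∀ y, 0 ≤ (R s r f).1 y
  R_le : ∀ s r f, (∀ y, 0 ≤ f.1 y) → ∀ y, (R s r f).1 y ≤ (Q r f).1 y
  Q_add : ∀ r u f, Q (r + u) f = Q r (Q u f)
  R_add : ∀ s r u f, R s (r + u) f = R s r (R (s + r) u f)
  exists_add : ∀ a b : I, a ≤ b → ∃ d, b = d + a
  Q_zero : ∀ f, Q 0 f = f
  R_zero : ∀ s f, R s 0 f = f
  Q_one_le : ∀ r y, (Q r 1).1 y ≤ 1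
  ν_nonneg : ∀ f : boundedMeasurable E, (∀ y, 0 ≤ f.1 y) → 0 ≤ ν f
  ν_one : ν 1 = 1
  t₁_pos : 0 < t₁
  c_pos : 0 < c
  minor : ∀ f : boundedMeasurable E, (∀ y, 0 ≤ f.1 y) →
    ∀ y, c * (Q t₁ 1).1 y * ν f ≤ (Q t₁ f).1 y
  harnack : ∀ t y, (Q t 1).1 y ≤ K * ν (Q t 1)
  R_pos : ∀ s r, 0 < (R s r 1).1 x
  conv : ∀ (V : I) (δ : ℝ), 0 < δ → ∀ᶠ s in atTop, ∀ v ≤ V,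
    (Q v 1).1 x - (R s v 1).1 x ≤ δ

/-! ### Order properties and geometric contraction of abstract killed semigroups. -/

namespace KilledPair
variable {I : AddSubmonoid ℝ≥0} {E : Type*} [MeasurableSpace E] (D : KilledPair I E)

/-- The mass function of the limiting semigroup. -/
abbrev q (r : I) : boundedMeasurable E := D.Q r 1

lemma one_apply (y : E) : (1 : boundedMeasurable E).1 y = 1 := rfl

lemma Q_nonneg (r : I) (f : boundedMeasurable E) (hf : ∀ y, 0 ≤ f.1 y) (y : E) :
    0 ≤ (D.Q r f).1 y :=
  (D.R_nonneg 0 r f hf y).trans (D.R_le 0 r f hf y)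

lemma Q_mono (r : I) {f g : boundedMeasurable E} (h : ∀ y, f.1 y ≤ g.1 y) (y : E) :
    (D.Q r f).1 y ≤ (D.Q r g).1 y := by
  have := D.Q_nonneg r (g - f) (fun z => sub_nonneg.2 (h z)) y
  rw [map_sub] at this
  exact sub_nonneg.1 this

lemma R_mono (s r : I) {f g : boundedMeasurable E} (h : ∀ y, f.1 y ≤ g.1 y) (y : E) :
    (D.R s r f).1 y ≤ (D.R s r g).1 y := by
  have := D.R_nonneg s r (g - f) (fun z => sub_nonneg.2 (h z)) y
  rw [map_sub] at this
  exact sub_nonneg.1 this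

lemma ν_mono {f g : boundedMeasurable E} (h : ∀ y, f.1 y ≤ g.1 y) : D.ν f ≤ D.ν g := by
  have := D.ν_nonneg (g - f) (fun z => sub_nonneg.2 (h z))
  rw [map_sub] at this
  exact sub_nonneg.1 this

lemma Q_smul (r : I) (a : ℝ) (f : boundedMeasurable E) (y : E) :
    (D.Q r (a • f)).1 y = a * (D.Q r f).1 y := by rw [map_smul]; rfl

lemma R_smul (s r : I) (a : ℝ) (f : boundedMeasurable E) (y : E) :
    (D.R s r (a • f)).1 y = a * (D.R s r f).1 y := by rw [map_smul]; rfl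

lemma Q_sub (r : I) (f g : boundedMeasurable E) (y : E) :
    (D.Q r (f - g)).1 y = (D.Q r f).1 y - (D.Q r g).1 y := by rw [map_sub]; rfl

lemma R_sub (s r : I) (f g : boundedMeasurable E) (y : E) :
    (D.R s r (f - g)).1 y = (D.R s r f).1 y - (D.R s r g).1 y := by rw [map_sub]; rfl

lemma ν_smul (a : ℝ) (f : boundedMeasurable E) : D.ν (a • f) = a * D.ν f := by
  rw [map_smul]; rfl

lemma q_add (r u : I) : D.q (r + u) = D.Q r (D.q u) := D.Q_add r u 1

lemma q_nonneg (r : I) (y : E) : 0 ≤ (D.q r).1 y := D.Q_nonneg r 1 (fun _ => zero_le_one) y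

lemma q_anti (r u : I) (y : E) : (D.q (r + u)).1 y ≤ (D.q r).1 y := by
  rw [q_add]; exact D.Q_mono r (D.Q_one_le u) y

lemma R_one_le (s r : I) (y : E) : (D.R s r 1).1 y ≤ 1 :=
  (D.R_le s r 1 (fun _ => zero_le_one) y).trans (D.Q_one_le r y)

lemma R_anti (s r u : I) (y : E) : (D.R s (r + u) 1).1 y ≤ (D.R s r 1).1 y := by
  rw [D.R_add]; exact D.R_mono s r (D.R_one_le _ u) y

lemma q_pos (r : I) : 0 < (D.q r).1 D.x :=
  (D.R_pos 0 r).trans_le (D.R_le 0 r 1 (fun _ => zero_le_one) D.x)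

lemma one_le_K : 1 ≤ D.K := by
  have := D.harnack 0 D.x
  rwa [D.Q_zero, D.ν_one, mul_one] at this

lemma K_pos : 0 < D.K := zero_lt_one.trans_le D.one_le_K

lemma νq_pos (r : I) : 0 < D.ν (D.q r) :=
  pos_of_mul_pos_right ((D.q_pos r).trans_le (D.harnack r D.x)) D.K_pos.le

lemma c_le_one : D.c ≤ 1 := by
  have := D.minor 1 (fun _ => zero_le_one) D.x
  rw [D.ν_one] at this
  have h := D.q_pos D.t₁
  by_contra! h'
  nlinarith

/-- The contraction rate. -/
noncomputable def ρ : ℝ := 1 - D.c / D.K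

lemma ρ_nonneg : 0 ≤ D.ρ :=
  sub_nonneg.2 ((div_le_one D.K_pos).2 (D.c_le_one.trans D.one_le_K))

lemma ρ_lt_one : D.ρ < 1 := sub_lt_self _ (div_pos D.c_pos D.K_pos)

lemma minor_of_le {t : I} (ht : D.t₁ ≤ t)
    (f : boundedMeasurable E) (hf : ∀ y, 0 ≤ f.1 y) (y : E) :
    D.c * D.ν f * (D.q t).1 y ≤ (D.Q t f).1 y := by
  obtain ⟨r, rfl⟩ := D.exists_add _ _ ht
  rw [D.Q_add, q_add, ← Q_smul]
  refine D.Q_mono r (fun z => ?_) y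
  have := D.minor f hf z
  change D.c * D.ν f * (D.Q D.t₁ 1).1 z ≤ _
  linarith

lemma ν_minor_of_le {t : I} (ht : D.t₁ ≤ t)
    (f : boundedMeasurable E) (hf : ∀ y, 0 ≤ f.1 y) :
    D.c * D.ν f * D.ν (D.q t) ≤ D.ν (D.Q t f) := by
  rw [← ν_smul]
  exact D.ν_mono (D.minor_of_le ht f hf)

/-- Geometric contraction of the ratios `Q f / Q 1`. -/
lemma exists_ratio (a : ℝ) (w : I) (f : boundedMeasurable E) (hf : ∀ y, 0 ≤ f.1 y)
    (hfa : ∀ y, f.1 y ≤ a * (D.q w).1 y) (n : ℕ) :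
    ∃ lo : ℝ, 0 ≤ lo ∧ (∀ y, lo * (D.q (n • D.t₁ + w)).1 y ≤ (D.Q (n • D.t₁) f).1 y) ∧
      ∀ y, (D.Q (n • D.t₁) f).1 y ≤ (lo + D.ρ ^ n * a) * (D.q (n • D.t₁ + w)).1 y := by
  induction n with
  | zero =>
    refine ⟨0, le_rfl, fun y => ?_, fun y => ?_⟩
    · simpa [D.Q_zero] using hf y
    · simpa [D.Q_zero] using hfa y
  | succ n ih =>
    obtain ⟨lo, hlo, h1, h2⟩ := ih
    set F := D.Q (n • D.t₁) f with hF
    set p := D.q (n • D.t₁ + w) with hp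
    set hi := lo + D.ρ ^ n * a with hhi
    have e1 : D.Q ((n + 1) • D.t₁) f = D.Q D.t₁ F := by
      rw [succ_nsmul', D.Q_add]
    have e2 : D.q ((n + 1) • D.t₁ + w) = D.Q D.t₁ p := by
      rw [succ_nsmul', add_assoc, q_add]
    have hνp : 0 < D.ν p := D.νq_pos _
    have hmass : ∀ y, (D.Q D.t₁ p).1 y ≤ D.K * D.ν p * (D.q D.t₁).1 y := fun y => by
      rw [← Q_smul]
      refine D.Q_mono _ (fun z => ?_) y
      have := D.harnack (n • D.t₁ + w) z
      change p.1 z ≤ D.K * D.ν p * 1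
      rwa [mul_one]
    -- Minorization and Harnack together: after time `t₁`, any `G ≥ 0` dominates the fraction `c /
    -- K` of its `ν`-ratio to `p`. Applied to `F - lo • p` and `hi • p - F`, this moves both bounds
    -- towards `ν F / ν p` and shrinks their gap by `1 - c / K`.
    have key : ∀ G : boundedMeasurable E, (∀ y, 0 ≤ G.1 y) → ∀ y,
        D.c / D.K * (D.ν G / D.ν p) * (D.Q D.t₁ p).1 y ≤ (D.Q D.t₁ G).1 y := fun G hG y => by
      refine le_trans ?_ (D.minor G hG y)
      have hG0 := D.ν_nonneg G hG
      calc _ ≤ D.c / D.K * (D.ν G / D.ν p) * (D.K * D.ν p * (D.q D.t₁).1 y) := by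
            refine mul_le_mul_of_nonneg_left (hmass y) ?_
            have := D.c_pos; have := D.K_pos
            positivity
        _ = _ := by
            have := D.K_pos.ne'
            field_simp
    have k1 : ∀ y, D.c / D.K * (D.ν F / D.ν p - lo) * (D.Q D.t₁ p).1 y ≤
        (D.Q D.t₁ F).1 y - lo * (D.Q D.t₁ p).1 y := fun y => by
      have := key (F - lo • p) (fun z => sub_nonneg.2 (h1 z)) y
      rwa [map_sub, ν_smul, Q_sub, Q_smul, sub_div, mul_div_assoc, div_self hνp.ne',
        mul_one] at this
    have k2 : ∀ y, D.c / D.K * (hi - D.ν F / D.ν p) * (D.Q D.t₁ p).1 y ≤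
        hi * (D.Q D.t₁ p).1 y - (D.Q D.t₁ F).1 y := fun y => by
      have := key (hi • p - F) (fun z => sub_nonneg.2 (h2 z)) y
      rwa [map_sub, ν_smul, Q_sub, Q_smul, sub_div, mul_div_assoc, div_self hνp.ne',
        mul_one] at this
    refine ⟨lo + D.c / D.K * (D.ν F / D.ν p - lo), ?_, fun y => ?_, fun y => ?_⟩
    · have : lo ≤ D.ν F / D.ν p := by
        rw [le_div_iff₀ hνp, ← ν_smul]; exact D.ν_mono h1
      have h3 : 0 ≤ D.c / D.K := (div_pos D.c_pos D.K_pos).le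
      have := mul_nonneg h3 (sub_nonneg.2 this)
      linarith
    · rw [e1, e2]; linarith [k1 y]
    · rw [e1, e2]
      have := k2 y
      have e3 : D.ρ ^ (n + 1) * a = (1 - D.c / D.K) * (hi - lo) := by
        rw [hhi, pow_succ, ρ]; ring
      rw [e3]
      linarith

/-! ### Mass lost at the moving boundary, uniformly in past and future. -/

lemma le_add_left' (a b : I) : a ≤ b + a := Subtype.coe_le_coe.1 (by simp)

lemma le_add_right' (a b : I) : a ≤ a + b := Subtype.coe_le_coe.1 (by simp)

lemma eventually_forall_ge {p : I → Prop} (h : ∀ᶠ s in atTop, p s) :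
    ∀ᶠ s in atTop, ∀ r, p (s + r) := by
  obtain ⟨s₀, hs₀⟩ := eventually_atTop.1 h
  exact eventually_atTop.2 ⟨s₀, fun s hs r => hs₀ _ (hs.trans (le_add_right' s r))⟩

/-- The difference `Q r - R s r` is a positive operator, here applied to `a - g ≥ 0`. -/
lemma Q_sub_R_le (s r : I) (a : ℝ) (g : boundedMeasurable E) (hg : ∀ y, g.1 y ≤ a) (y : E) :
    (D.Q r g - D.R s r g).1 y ≤ (a • (D.q r - D.R s r 1)).1 y := by
  have := D.R_le s r (a • 1 - g) (fun z => by
    change 0 ≤ a * 1 - g.1 z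
    linarith [hg z]) y
  rw [R_sub, Q_sub, Q_smul, R_smul] at this
  change (D.Q r g).1 y - (D.R s r g).1 y ≤ a * ((D.Q r 1).1 y - (D.R s r 1).1 y)
  linarith

lemma ν_Q_sub_R_le (s r : I) (a : ℝ) (g : boundedMeasurable E) (hg : ∀ y, g.1 y ≤ a) :
    D.ν (D.Q r g) - D.ν (D.R s r g) ≤ a * (D.ν (D.q r) - D.ν (D.R s r 1)) := by
  rw [← map_sub, ← map_sub, ← ν_smul]
  exact D.ν_mono (D.Q_sub_R_le s r a g hg)

/-- Transfers convergence from `x` to `ν`. Starting from `x` a time `t₁` earlier, the minorization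
puts mass at least `c q_{t₁}(x)` along `ν`, so a loss under `ν` shows up as a proportional loss
under `x`. -/
lemma eventually_ν_sub_le (V : I) (δ : ℝ) (hδ : 0 < δ) :
    ∀ᶠ s in atTop, ∀ v ≤ V, D.ν (D.q v) - D.ν (D.R s v 1) ≤ δ := by
  have hq := D.q_pos D.t₁
  have hc := D.c_pos
  obtain ⟨s₀, hs₀⟩ := eventually_atTop.1
    (D.conv (D.t₁ + V) (D.c * (D.q D.t₁).1 D.x * δ) (by positivity))
  refine eventually_atTop.2 ⟨s₀ + D.t₁, fun s hs v hv => ?_⟩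
  obtain ⟨d, rfl⟩ := D.exists_add _ _ hs
  have h1 := hs₀ (d + s₀) (le_add_left' _ _) (D.t₁ + v) (add_le_add_right hv _)
  have h2 := D.minor (D.q v - D.R (d + s₀ + D.t₁) v 1)
    (fun y => sub_nonneg.2 (D.R_le _ _ 1 (fun _ => zero_le_one) y)) D.x
  have h3 := D.R_le (d + s₀) D.t₁ (D.R (d + s₀ + D.t₁) v 1)
    (D.R_nonneg _ _ _ fun _ => zero_le_one) D.x
  rw [D.R_add, D.Q_add] at h1
  rw [Q_sub, map_sub] at h2
  rw [← add_assoc]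
  have h4 : D.c * (D.q D.t₁).1 D.x * (D.ν (D.q v) - D.ν (D.R (d + s₀ + D.t₁) v 1)) ≤
      D.c * (D.q D.t₁).1 D.x * δ := by linarith
  exact le_of_mul_le_mul_left h4 (by positivity)

lemma exists_pow_le (δ : ℝ) (hδ : 0 < δ) : ∃ n₀ : ℕ, ∀ n ≥ n₀, D.ρ ^ n ≤ δ := by
  have := (tendsto_pow_atTop_nhds_zero_of_lt_one D.ρ_nonneg D.ρ_lt_one).eventually
    (gt_mem_nhds hδ)
  obtain ⟨n₀, h⟩ := eventually_atTop.1 this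
  exact ⟨n₀, fun n hn => (h n hn).le⟩

lemma t₁_le_nsmul {n : ℕ} (hn : 1 ≤ n) : D.t₁ ≤ n • D.t₁ := by
  obtain ⟨m, rfl⟩ := Nat.exists_eq_add_of_le hn
  rw [add_nsmul, one_nsmul]
  exact le_add_right' _ _

/-- A Harnack inequality for the moving boundary, uniform in the horizon. -/
lemma exists_harnack [Archimedean I] : ∃ L, D.K ≤ L ∧
    ∀ᶠ s in atTop, ∀ u y, (D.R s u 1).1 y ≤ L * D.ν (D.R s u 1) := by
  have hK := D.K_pos
  have hc := D.c_pos
  obtain ⟨n₀, hn₀⟩ := D.exists_pow_le (D.c / (8 * D.K)) (by positivity)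
  set n := max n₀ 1
  have hρ := hn₀ n (le_max_left _ _)
  set N := n • D.t₁ with hN
  have hN1 : D.t₁ ≤ N := D.t₁_le_nsmul (le_max_right _ _)
  set β := D.ν (D.q N) with hβ
  have hβ0 : 0 < β := D.νq_pos N
  -- `2 / β` handles horizons up to `N`, where `ν` keeps mass at least `β / 2`; `2 * K` leaves room
  -- for the errors in the induction.
  set L := max (2 * D.K) (2 / β) with hL
  have hL0 : 0 < L := lt_max_of_lt_left (by positivity)
  have hL1 : 2 * D.K ≤ L := le_max_left _ _
  have hL2 : 2 / β ≤ L := le_max_right _ _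
  refine ⟨L, by linarith, ?_⟩
  obtain ⟨δ, hδ, hδ1, hδ2, hδ3⟩ : ∃ δ : ℝ, 0 < δ ∧ δ ≤ D.c * β / (8 * D.K) ∧
      δ ≤ D.c * β / (2 * L) ∧ δ ≤ β / 2 :=
    ⟨min (D.c * β / (8 * D.K)) (min (D.c * β / (2 * L)) (β / 2)), by positivity,
      min_le_left _ _, (min_le_right _ _).trans (min_le_left _ _),
      (min_le_right _ _).trans (min_le_right _ _)⟩
  obtain ⟨s₀, hs₀⟩ := eventually_atTop.1 (D.eventually_ν_sub_le N δ hδ)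
  refine eventually_atTop.2 ⟨s₀, ?_⟩
  have base : ∀ s ≥ s₀, ∀ u ≤ N, ∀ y, (D.R s u 1).1 y ≤ L * D.ν (D.R s u 1) := by
    intro s hs u hu y
    have h1 := hs₀ s hs N le_rfl
    obtain ⟨d, hd⟩ := D.exists_add _ _ hu
    have h2 : D.ν (D.R s N 1) ≤ D.ν (D.R s u 1) := by
      rw [hd, add_comm]; exact D.ν_mono (D.R_anti s u d)
    have h3 : β / 2 ≤ D.ν (D.R s u 1) := by linarith
    calc _ ≤ 1 := D.R_one_le s u y
      _ = 2 / β * (β / 2) := by field_simp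
      _ ≤ _ := mul_le_mul hL2 h3 (by positivity) hL0.le
  have step : ∀ k : ℕ, ∀ s ≥ s₀, ∀ u ≤ k • N, ∀ y,
      (D.R s u 1).1 y ≤ L * D.ν (D.R s u 1) := by
    intro k
    induction k with
    | zero =>
      intro s hs u hu
      exact base s hs u (hu.trans (by rw [zero_nsmul]; exact Subtype.coe_le_coe.1 (by simp)))
    | succ k ih =>
      intro s hs u hu y
      rcases le_total u N with huN | huN
      · exact base s hs u huN y
      obtain ⟨u', rfl⟩ := D.exists_add _ _ huN
      rw [add_nsmul, one_nsmul] at hu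
      have hu' : u' ≤ k • N := le_of_add_le_add_right hu
      rw [add_comm u' N]
      set g := D.R (s + N) u' 1 with hg
      set b' := D.ν g with hb'
      have hga : ∀ z, g.1 z ≤ L * b' := ih (s + N) (hs.trans (le_add_right' _ _)) u' hu'
      have hg0 : ∀ z, 0 ≤ g.1 z := D.R_nonneg _ _ _ fun _ => zero_le_one
      have hb0 : 0 ≤ b' := D.ν_nonneg g hg0
      obtain ⟨lo, hlo, m1, m2⟩ := D.exists_ratio (L * b') 0 g hg0
        (fun z => by rw [q, D.Q_zero, one_apply, mul_one]; exact hga z) n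
      rw [add_zero, ← hN] at m1 m2
      rw [D.R_add, ← hg]
      set b := D.ν (D.R s N g) with hb
      have hloss : D.ν (D.Q N g) - b ≤ L * b' * δ :=
        (D.ν_Q_sub_R_le s N _ g hga).trans
          (mul_le_mul_of_nonneg_left (hs₀ s hs N le_rfl) (by positivity))
      have hlow : D.c * b' * β ≤ D.ν (D.Q N g) := D.ν_minor_of_le hN1 g hg0
      have hm1 : lo * β ≤ D.ν (D.Q N g) := by rw [hβ, ← ν_smul]; exact D.ν_mono m1
      have hbb : D.c * β / 2 * b' ≤ b := by
        have : L * δ ≤ D.c * β / 2 := by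
          calc L * δ ≤ L * (D.c * β / (2 * L)) := mul_le_mul_of_nonneg_left hδ2 hL0.le
            _ = _ := by field_simp
        nlinarith
      have hy : (D.R s N g).1 y ≤ D.K * (D.ν (D.Q N g) + D.ρ ^ n * (L * b') * β) := by
        calc _ ≤ (D.Q N g).1 y := D.R_le _ _ _ hg0 y
          _ ≤ _ := m2 y
          _ ≤ (lo + D.ρ ^ n * (L * b')) * (D.K * β) := by
            refine mul_le_mul_of_nonneg_left (D.harnack N y) ?_
            have := D.ρ_nonneg
            positivity
          _ ≤ _ := by nlinarith
      -- Each of the two errors costs at most `L b / 4`, and the main term `K b` at most `L b / 2`.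
      -- The constant `L` is thus recovered and does not grow with the horizon.
      have e1 : D.K * (L * b' * δ) ≤ L / 4 * b := by
        have : D.K * δ ≤ D.c * β / 8 := by
          calc D.K * δ ≤ D.K * (D.c * β / (8 * D.K)) := mul_le_mul_of_nonneg_left hδ1 hK.le
            _ = _ := by field_simp
        have h5 : D.K * δ * (L * b') ≤ D.c * β / 8 * (L * b') :=
          mul_le_mul_of_nonneg_right this (by positivity)
        have h6 : L * (D.c * β / 2 * b') ≤ L * b := mul_le_mul_of_nonneg_left hbb hL0.le
        linarith
      have e2 : D.K * (D.ρ ^ n * (L * b') * β) ≤ L / 4 * b := by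
        have : D.K * D.ρ ^ n ≤ D.c / 8 := by
          calc D.K * D.ρ ^ n ≤ D.K * (D.c / (8 * D.K)) := mul_le_mul_of_nonneg_left hρ hK.le
            _ = _ := by field_simp
        have h5 : D.K * D.ρ ^ n * (L * b' * β) ≤ D.c / 8 * (L * b' * β) :=
          mul_le_mul_of_nonneg_right this (by positivity)
        have h6 : L * (D.c * β / 2 * b') ≤ L * b := mul_le_mul_of_nonneg_left hbb hL0.le
        linarith
      have hb0' : 0 ≤ b := le_trans (by positivity) hbb
      have e3 : 2 * D.K * b ≤ L * b := mul_le_mul_of_nonneg_right hL1 hb0'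
      nlinarith
  intro s hs u y
  obtain ⟨k, hk⟩ := Archimedean.arch u (D.t₁_pos.trans_le hN1)
  exact step k s hs u hk y

/-- Killing by the moving boundary costs little after a window of length `n • t₁`. -/
lemma loss_le {n : ℕ} (hn : 1 ≤ n) (s r v : I) (ε a : ℝ) (ha : 0 ≤ a)
    (H : (D.R s r (D.q (n • D.t₁))).1 D.x - (D.R s r (D.R (s + r) (n • D.t₁) 1)).1 D.x ≤
      D.c / (2 * D.K) * (D.R s r (D.q (n • D.t₁))).1 D.x)
    (hε : D.ν (D.q (n • D.t₁ + v)) - D.ν (D.R (s + r) (n • D.t₁ + v) 1) ≤ ε)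
    (g : boundedMeasurable E) (hg0 : ∀ y, 0 ≤ g.1 y) (hga : ∀ y, g.1 y ≤ a) :
    (D.R s (r + n • D.t₁) (D.Q v g)).1 D.x -
        (D.R s (r + n • D.t₁) (D.R (s + (r + n • D.t₁)) v g)).1 D.x ≤
      a * (ε / D.ν (D.q (n • D.t₁ + v)) + D.ρ ^ n) *
        (2 * (D.R s (r + n • D.t₁) (D.q v)).1 D.x) := by
  have hK := D.K_pos
  have hc := D.c_pos
  have hρ := D.ρ_nonneg
  set M := n • D.t₁ with hM
  have hM1 : D.t₁ ≤ M := D.t₁_le_nsmul hn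
  -- `Ψ` is the loss in the last window. By contraction `Q_M Ψ` is nearly `lo` times `q_{M+v}`, and
  -- integration against `ν` bounds `lo` by the loss seen from `ν`.
  set Ψ := D.Q v g - D.R (s + (r + M)) v g with hΨ
  have hΨ0 : ∀ y, 0 ≤ Ψ.1 y := fun y => sub_nonneg.2 (D.R_le _ _ g hg0 y)
  have hΨa : ∀ y, Ψ.1 y ≤ a * (D.q v).1 y := fun y => by
    have h1 : (D.Q v g).1 y ≤ a * (D.q v).1 y := by
      rw [← Q_smul]
      exact D.Q_mono v (fun z => by change _ ≤ a * 1; linarith [hga z]) y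
    have h2 := D.R_nonneg (s + (r + M)) v g hg0 y
    change (D.Q v g).1 y - (D.R (s + (r + M)) v g).1 y ≤ _
    linarith
  obtain ⟨lo, hlo, m1, m2⟩ := D.exists_ratio a v Ψ hΨ0 hΨa n
  rw [← hM] at m1 m2
  set Z := (D.R s r (D.q (M + v))).1 D.x with hZ
  have hZ0 : 0 ≤ Z := D.R_nonneg _ _ _ (D.q_nonneg _) _
  have hp := D.νq_pos (M + v)
  have hlo' : lo ≤ a * ε / D.ν (D.q (M + v)) := by
    rw [le_div_iff₀ hp, ← ν_smul]
    refine (D.ν_mono m1).trans ?_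
    have h1 : D.ν (D.Q M Ψ) ≤ D.ν (D.Q (M + v) g) - D.ν (D.R (s + r) (M + v) g) := by
      rw [hΨ, map_sub, map_sub, D.Q_add, D.R_add, ← add_assoc]
      refine sub_le_sub_left (D.ν_mono (D.R_le _ _ _ (D.R_nonneg _ _ _ hg0))) _
    exact h1.trans ((D.ν_Q_sub_R_le _ _ a g hga).trans (mul_le_mul_of_nonneg_left hε ha))
  have hup : (D.R s (r + M) Ψ).1 D.x ≤ (lo + D.ρ ^ n * a) * Z := by
    rw [D.R_add, hZ, ← R_smul]
    refine D.R_mono _ _ (fun y => ?_) _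
    exact (D.R_le _ _ _ hΨ0 y).trans (m2 y)
  -- The factor `c / (2 * K)` in `H` is offset by Harnack (`K`) and the minorization (`c`), so
  -- killing over the window `M` removes at most half of `Z`.
  have hden : Z ≤ 2 * (D.R s (r + M) (D.q v)).1 D.x := by
    have h1 := D.R_mono s r
      (D.Q_sub_R_le (s + r) M (D.K * D.ν (D.q v)) (D.q v) (D.harnack v)) D.x
    rw [R_sub, R_smul, R_sub, ← D.R_add, ← q_add] at h1
    have h2 : D.c * D.ν (D.q v) * (D.R s r (D.q M)).1 D.x ≤ Z := by
      rw [hZ, ← R_smul, q_add]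
      exact D.R_mono _ _ (D.minor_of_le hM1 _ (D.q_nonneg v)) _
    have h3 : D.K * D.ν (D.q v) * ((D.R s r (D.q M)).1 D.x -
        (D.R s r (D.R (s + r) M 1)).1 D.x) ≤
        D.K * D.ν (D.q v) * (D.c / (2 * D.K) * (D.R s r (D.q M)).1 D.x) :=
      mul_le_mul_of_nonneg_left H (mul_nonneg hK.le (D.νq_pos v).le)
    have h4 : D.K * D.ν (D.q v) * (D.c / (2 * D.K) * (D.R s r (D.q M)).1 D.x) =
        D.c * D.ν (D.q v) * (D.R s r (D.q M)).1 D.x / 2 := by field_simp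
    change Z - _ ≤ _ at h1
    linarith
  rw [← R_sub]
  refine hup.trans ?_
  have h5 : lo + D.ρ ^ n * a ≤ a * (ε / D.ν (D.q (M + v)) + D.ρ ^ n) := by
    rw [mul_add, ← mul_div_assoc]; linarith
  exact mul_le_mul h5 hden hZ0 (le_trans (by positivity) h5)

/-- The conditioned process does not accumulate near the moving boundary. -/
lemma eventually_mass {n : ℕ} (hn : 1 ≤ n) (hρ : D.ρ ^ n ≤ D.c / (8 * D.K)) :
    ∀ᶠ s in atTop, ∀ k : ℕ,
      (D.R s (k • n • D.t₁) (D.q (n • D.t₁))).1 D.x -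
          (D.R s (k • n • D.t₁) (D.R (s + k • n • D.t₁) (n • D.t₁) 1)).1 D.x ≤
        D.c / (2 * D.K) * (D.R s (k • n • D.t₁) (D.q (n • D.t₁))).1 D.x := by
  have hK := D.K_pos
  have hc := D.c_pos
  set M := n • D.t₁ with hM
  have hp := D.νq_pos (M + M)
  have hqx := D.q_pos M
  filter_upwards [eventually_forall_ge (D.eventually_ν_sub_le (M + M)
    (D.c / (8 * D.K) * D.ν (D.q (M + M))) (by positivity)),
    D.conv M (D.c / (2 * D.K) * (D.q M).1 D.x) (by positivity)] with s h1 h2 k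
  induction k with
  | zero => simpa [D.R_zero] using h2 M le_rfl
  | succ k ih =>
    rw [add_nsmul, one_nsmul]
    -- Both error terms are at most `c / (8 * K)`; with the factor 2 of `loss_le` they give `c / (2
    -- * K)`, the induction hypothesis one window later.
    have := D.loss_le hn s (k • M) M _ 1 zero_le_one ih (h1 (k • M) (M + M) le_rfl) 1
      (fun _ => zero_le_one) (fun _ => le_rfl)
    refine this.trans ?_
    rw [← hM, mul_div_assoc, div_self hp.ne', one_mul, mul_one]
    have hr := D.R_nonneg s (k • M + M) (D.q M) (D.q_nonneg _) D.x
    have h3 : D.c / (8 * D.K) + D.ρ ^ n ≤ D.c / (4 * D.K) := by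
      have : D.c / (4 * D.K) = D.c / (8 * D.K) + D.c / (8 * D.K) := by field_simp; norm_num
      linarith
    calc _ ≤ D.c / (4 * D.K) * (2 * (D.R s (k • M + M) (D.q M)).1 D.x) :=
          mul_le_mul_of_nonneg_right h3 (by positivity)
      _ = _ := by field_simp; norm_num

end KilledPair

/-! ### Elementary comparison of quotients. -/

lemma abs_div_sub_div_le_of_loss {a b a' b' δ : ℝ} (ha : 0 ≤ a) (haa : a ≤ a')
    (hdiff : a' - a ≤ b' - b) (hloss : b' - b ≤ δ * b') (hb : a' ≤ b') (hb' : 0 < b')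
    (hδ : δ ≤ 1 / 2) : |a / b - a' / b'| ≤ 2 * δ := by
  have hb0 : b' / 2 ≤ b := by nlinarith
  have hbpos : 0 < b := by linarith
  have hδ0 : 0 ≤ δ := by
    by_contra! h
    nlinarith
  have e : a / b - a' / b' = (a * b' - a' * b) / (b * b') := by field_simp
  have hbb : 0 < b * b' := by positivity
  rw [e, abs_le, le_div_iff₀ hbb, div_le_iff₀ hbb]
  have h1 : δ * b' * b' ≤ δ * b' * (2 * b) :=
    mul_le_mul_of_nonneg_left (by linarith) (by positivity)
  constructor
  · have h2 : (a' - a) * b' ≤ δ * b' * b' := by nlinarith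
    have h3 : a' * b ≤ a' * b' := by nlinarith
    nlinarith
  · have h2 : a' * (b' - b) ≤ b' * (δ * b') := by
      refine mul_le_mul hb hloss (by linarith) hb'.le
    nlinarith

lemma abs_div_sub_div_le_of_comparable {a b a' b' lo δ : ℝ} (hlo : 0 < lo) (hδ : 0 ≤ δ)
    (h1 : lo * a' ≤ a) (h2 : a ≤ lo * (1 + δ) * a') (h3 : lo * b' ≤ b)
    (h4 : b ≤ lo * (1 + δ) * b') (ha' : 0 ≤ a') (hab : a' ≤ b') (hb' : 0 < b') :
    |a / b - a' / b'| ≤ δ := by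
  have hb : 0 < b := lt_of_lt_of_le (by positivity) h3
  have e : a / b - a' / b' = (a * b' - a' * b) / (b * b') := by field_simp
  have hbb : 0 < b * b' := by positivity
  rw [e, abs_le, le_div_iff₀ hbb, div_le_iff₀ hbb]
  constructor
  · have h5 : a' * b ≤ a' * (lo * (1 + δ) * b') := mul_le_mul_of_nonneg_left h4 ha'
    have h6 : lo * a' * b' ≤ a * b' := mul_le_mul_of_nonneg_right h1 hb'.le
    have h7 : δ * (lo * b') * a' ≤ δ * b * b' :=
      mul_le_mul (mul_le_mul_of_nonneg_left h3 hδ) hab ha' (by positivity)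
    nlinarith
  · have h5 : a * b' ≤ lo * (1 + δ) * a' * b' := mul_le_mul_of_nonneg_right h2 hb'.le
    have h6 : a' * (lo * b') ≤ a' * b := mul_le_mul_of_nonneg_left h3 ha'
    have h7 : δ * (lo * b') * a' ≤ δ * b * b' :=
      mul_le_mul (mul_le_mul_of_nonneg_left h3 hδ) hab ha' (by positivity)
    nlinarith

lemma abs_div_sub_div_le_of_mem {a b a' b' lo w : ℝ} (hb : 0 < b) (hb' : 0 < b')
    (h1 : lo * b ≤ a) (h2 : a ≤ (lo + w) * b) (h3 : lo * b' ≤ a')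
    (h4 : a' ≤ (lo + w) * b') : |a / b - a' / b'| ≤ w := by
  rw [← le_div_iff₀ hb] at h1
  rw [← div_le_iff₀ hb] at h2
  rw [← le_div_iff₀ hb'] at h3
  rw [← div_le_iff₀ hb'] at h4
  rw [abs_le]
  constructor <;> linarith

/-! ### Comparison of the conditioned quotients. -/

namespace KilledPair
variable {I : AddSubmonoid ℝ≥0} {E : Type*} [MeasurableSpace E] (D : KilledPair I E)

lemma mul_le_of_le_one {b g : boundedMeasurable E} (hb : ∀ y, b.1 y ≤ 1)
    (hg : ∀ y, 0 ≤ g.1 y) (y : E) : (b * g).1 y ≤ g.1 y :=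
  mul_le_of_le_one_left (hg y) (hb y)

lemma mul_apply_nonneg {b g : boundedMeasurable E} (hb : ∀ y, 0 ≤ b.1 y)
    (hg : ∀ y, 0 ≤ g.1 y) (y : E) : 0 ≤ (b * g).1 y := mul_nonneg (hb y) (hg y)

/-- The loss of mass is negligible on windows of bounded length, uniformly in the position of
the window and in the terminal function. -/
lemma eventually_loss {n : ℕ} (hn : 1 ≤ n) (hρ : D.ρ ^ n ≤ D.c / (8 * D.K)) {L δ : ℝ}
    (hL : 0 < L) (hδ : 0 < δ) (hρ' : D.ρ ^ n ≤ D.c * δ / (4 * L)) (V : I) :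
    ∀ᶠ s in atTop, ∀ r v, (r = 0 ∨ ∃ k : ℕ, r = k • n • D.t₁ + n • D.t₁) → v ≤ V →
      ∀ g : boundedMeasurable E, (∀ y, 0 ≤ g.1 y) → (∀ y, g.1 y ≤ L * D.ν g) →
        D.c * D.ν g * (D.R s r (D.q v)).1 D.x ≤ (D.R s r (D.Q v g)).1 D.x →
        (D.R s r (D.Q v g)).1 D.x - (D.R s r (D.R (s + r) v g)).1 D.x ≤
          δ * (D.R s r (D.Q v g)).1 D.x := by
  have hc := D.c_pos
  set M := n • D.t₁ with hM
  have hp := D.νq_pos (M + V)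
  have hqx := D.q_pos V
  filter_upwards [eventually_forall_ge (D.eventually_ν_sub_le (M + V)
    (D.c * δ / (4 * L) * D.ν (D.q (M + V))) (by positivity)), D.eventually_mass hn hρ,
    D.conv V (δ * D.c * (D.q V).1 D.x / L) (by positivity)] with s h1 h2 h3 r v hr hv g hg hga hd
  have hν := D.ν_nonneg g hg
  obtain ⟨e, he⟩ := D.exists_add _ _ hv
  rcases hr with rfl | ⟨k, rfl⟩
  -- With no past, the convergence at `x` applies directly; `loss_le` needs a preceding window of
  -- length `M`.
  · rw [D.R_zero, D.R_zero, add_zero]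
    rw [D.R_zero, D.R_zero] at hd
    have h4 := D.Q_sub_R_le s v _ g hga D.x
    have h5 : L * D.ν g * ((D.q v).1 D.x - (D.R s v 1).1 D.x) ≤
        L * D.ν g * (δ * D.c * (D.q V).1 D.x / L) :=
      mul_le_mul_of_nonneg_left (h3 v hv) (by positivity)
    have h6 : L * D.ν g * (δ * D.c * (D.q V).1 D.x / L) =
        δ * (D.c * D.ν g * (D.q V).1 D.x) := by field_simp
    have h7 : (D.q V).1 D.x ≤ (D.q v).1 D.x := by rw [he, add_comm]; exact D.q_anti v e D.x
    have h8 : D.c * D.ν g * (D.q V).1 D.x ≤ D.c * D.ν g * (D.q v).1 D.x :=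
      mul_le_mul_of_nonneg_left h7 (by positivity)
    change (D.Q v g).1 D.x - (D.R s v g).1 D.x ≤
      L * D.ν g * ((D.q v).1 D.x - (D.R s v 1).1 D.x) at h4
    have h9 := mul_le_mul_of_nonneg_left (h8.trans hd) hδ.le
    linarith
  · have hp' := D.νq_pos (M + v)
    refine (D.loss_le hn s (k • M) v _ (L * D.ν g) (by positivity) (h2 k)
      (h1 (k • M) (M + v) (add_le_add_right hv _)) g hg hga).trans ?_
    rw [← hM]
    have h4 : D.ν (D.q (M + V)) ≤ D.ν (D.q (M + v)) := by
      rw [he, add_comm e v, ← add_assoc]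
      exact D.ν_mono (D.q_anti _ _)
    have h5 : D.c * δ / (4 * L) * D.ν (D.q (M + V)) / D.ν (D.q (M + v)) ≤
        D.c * δ / (4 * L) := by
      rw [div_le_iff₀ hp']
      exact mul_le_mul_of_nonneg_left h4 (by positivity)
    have h6 := D.R_nonneg s (k • M + M) (D.q v) (D.q_nonneg v) D.x
    calc _ ≤ L * D.ν g * (D.c * δ / (4 * L) + D.c * δ / (4 * L)) *
          (2 * (D.R s (k • M + M) (D.q v)).1 D.x) := by
          refine mul_le_mul_of_nonneg_right ?_ (by positivity)
          exact mul_le_mul_of_nonneg_left (add_le_add h5 hρ') (by positivity)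
      _ = δ * (D.c * D.ν g * (D.R s (k • M + M) (D.q v)).1 D.x) := by field_simp; ring
      _ ≤ _ := mul_le_mul_of_nonneg_left hd hδ.le

/-- Up to a multiplicative constant, the survival function over a long window does not depend on
the terminal function. -/
lemma exists_comparable {n : ℕ} (hn : 1 ≤ n) {L δ : ℝ} (hL : 0 < L) (hδ : 0 < δ) (hδ1 : δ ≤ 1)
    (hρ' : D.ρ ^ n ≤ D.c * δ / (4 * L)) (w : I) (g : boundedMeasurable E)
    (hw : w = n • D.t₁ ∨ g = 1) (hg : ∀ y, 0 ≤ g.1 y) (hga : ∀ y, g.1 y ≤ L * D.ν g)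
    (hν : 0 < D.ν g) :
    ∃ lo : ℝ, 0 < lo ∧ (∀ y, lo * (D.q w).1 y ≤ (D.Q w g).1 y) ∧
      ∀ y, (D.Q w g).1 y ≤ lo * (1 + δ) * (D.q w).1 y := by
  have hc := D.c_pos
  rcases hw with rfl | rfl
  · obtain ⟨lo, hlo, m1, m2⟩ := D.exists_ratio (L * D.ν g) 0 g hg
      (fun z => by rw [q, D.Q_zero, one_apply, mul_one]; exact hga z) n
    rw [add_zero] at m1 m2
    have hp := D.νq_pos (n • D.t₁)
    have h1 := D.ν_minor_of_le (D.t₁_le_nsmul hn) g hg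
    have h2 := D.ν_mono (g := (lo + D.ρ ^ n * (L * D.ν g)) • D.q (n • D.t₁)) m2
    rw [ν_smul] at h2
    have h3 := le_of_mul_le_mul_right (h1.trans h2) hp
    have h4 : D.ρ ^ n * (L * D.ν g) ≤ D.c * δ / 4 * D.ν g := by
      calc _ ≤ D.c * δ / (4 * L) * (L * D.ν g) := mul_le_mul_of_nonneg_right hρ' (by positivity)
        _ = _ := by field_simp
    have h5 : D.c * δ * D.ν g ≤ D.c * D.ν g := by
      have : 0 < D.c * D.ν g := by positivity
      nlinarith
    -- The oscillation is at most `c δ ν(g) / 4`, so this lower bound on `lo` turns it into a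
    -- relative error below `δ`.
    have h6 : D.c / 2 * D.ν g ≤ lo := by linarith
    refine ⟨lo, lt_of_lt_of_le (by positivity) h6, m1, fun y => (m2 y).trans ?_⟩
    refine mul_le_mul_of_nonneg_right ?_ (D.q_nonneg _ y)
    have h7 := mul_le_mul_of_nonneg_left h6 hδ.le
    have h8 := mul_nonneg hδ.le hlo
    linarith
  · refine ⟨1, one_pos, fun y => by rw [one_mul], fun y => ?_⟩
    have := D.q_nonneg w y
    change (D.q w).1 y ≤ _
    nlinarith

/-- Chooses where the past ends. Either there is no past, or `r` lies on the grid of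
`eventually_mass` with one window `M` before it, and `d ≥ M` is long enough for the past to be
forgotten. -/
lemma exists_split_before (D : KilledPair I E) [Archimedean I] {M : I} (hM : 0 < M) (t : I) :
    ∃ r d, t = r + d ∧ d ≤ M + M ∧ (r = 0 ∨ (∃ k : ℕ, r = k • M + M) ∧ M ≤ d) := by
  rcases le_or_gt t (M + M) with h | h
  · exact ⟨0, t, by simp, h, Or.inl rfl⟩
  obtain ⟨t', rfl⟩ := D.exists_add _ _ h.le
  obtain ⟨k, hk⟩ : ∃ k : ℕ, k • M ≤ t' ∧ t' < (k + 1) • M := by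
    have hex : ∃ k : ℕ, t' < (k + 1) • M := by
      obtain ⟨k, hk⟩ := Archimedean.arch t' hM
      refine ⟨k, hk.trans_lt ?_⟩
      rw [add_nsmul, one_nsmul]
      exact lt_add_of_pos_right _ hM
    classical
    refine ⟨Nat.find hex, ?_, Nat.find_spec hex⟩
    rcases Nat.eq_zero_or_pos (Nat.find hex) with h0 | h0
    · rw [h0, zero_nsmul]; exact Subtype.coe_le_coe.1 (by simp)
    · have := not_lt.1 (Nat.find_min hex (Nat.sub_lt h0 one_pos))
      rwa [show Nat.find hex - 1 + 1 = Nat.find hex from Nat.sub_add_cancel h0] at this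
  obtain ⟨d, hd⟩ := D.exists_add _ _ hk.1
  refine ⟨k • M + M, d + M, ?_, ?_, Or.inr ⟨⟨k, rfl⟩, le_add_left' _ _⟩⟩
  · rw [hd]; abel
  · refine add_le_add_left ?_ M
    have h2 := hk.2
    rw [hd, add_nsmul, one_nsmul, add_comm] at h2
    exact (lt_of_add_lt_add_left h2).le

/-- The error is `2δ` for replacing `R` by `Q` in the window, `δ` for each of the two futures, and
`δ` for the past. -/
theorem eventually_abs_sub_le [Archimedean I] {δ : ℝ} (hδ : 0 < δ) (hδ1 : δ ≤ 1 / 2) :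
    ∀ᶠ s in atTop, ∀ t T, ∀ b : boundedMeasurable E, (∀ y, 0 ≤ b.1 y) → (∀ y, b.1 y ≤ 1) →
      |(D.R s t (b * D.R (s + t) T 1)).1 D.x / (D.R s (t + T) 1).1 D.x -
        (D.Q t (b * D.q T)).1 D.x / (D.q (t + T)).1 D.x| ≤ 5 * δ := by
  have hc := D.c_pos
  have hK := D.K_pos
  obtain ⟨L, hKL, hLs⟩ := D.exists_harnack
  have hL : 0 < L := hK.trans_le hKL
  obtain ⟨n₁, hn₁⟩ := D.exists_pow_le (D.c / (8 * D.K)) (by positivity)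
  obtain ⟨n₂, hn₂⟩ := D.exists_pow_le (D.c * δ / (4 * L)) (by positivity)
  obtain ⟨n₃, hn₃⟩ := D.exists_pow_le δ hδ
  obtain ⟨n, hn, hr1, hr2, hr3⟩ : ∃ n, 1 ≤ n ∧ D.ρ ^ n ≤ D.c / (8 * D.K) ∧
      D.ρ ^ n ≤ D.c * δ / (4 * L) ∧ D.ρ ^ n ≤ δ :=
    ⟨n₁ + n₂ + n₃ + 1, by lia, hn₁ _ (by lia), hn₂ _ (by lia), hn₃ _ (by lia)⟩
  set M := n • D.t₁ with hM
  have hM1 : D.t₁ ≤ M := D.t₁_le_nsmul hn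
  filter_upwards [eventually_forall_ge hLs,
    D.eventually_loss hn hr1 hL hδ hr2 (M + M + M)] with s hs hloss t T b hb0 hb1
  obtain ⟨r, d, rfl, hd, hr⟩ := D.exists_split_before (D.t₁_pos.trans_le hM1) t
  obtain ⟨w, T', rfl, hw, hwT⟩ : ∃ w T', T = w + T' ∧ w ≤ M ∧ (w = M ∨ T' = 0) := by
    rcases le_total T M with h | h
    · exact ⟨T, 0, by simp, h, Or.inr rfl⟩
    · obtain ⟨T', rfl⟩ := D.exists_add _ _ h
      exact ⟨M, T', add_comm _ _, le_rfl, Or.inl rfl⟩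
  set g := D.R (s + (r + d) + w) T' 1 with hg
  have hg0 : ∀ y, 0 ≤ g.1 y := D.R_nonneg _ _ _ fun _ => zero_le_one
  have hga : ∀ y, g.1 y ≤ L * D.ν g := by
    have := hs (r + d + w) T'
    rwa [← add_assoc] at this
  have hgν : 0 < D.ν g :=
    pos_of_mul_pos_right ((D.R_pos _ T').trans_le (hga D.x)) hL.le
  have hwg : w = M ∨ g = 1 := hwT.imp_right fun h => by rw [hg, h, D.R_zero]
  have hwq : w = M ∨ D.q T' = 1 := hwT.imp_right fun h => by rw [h, q, D.Q_zero]
  have hqa : ∀ y, (D.q T').1 y ≤ L * D.ν (D.q T') := fun y =>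
    (D.harnack T' y).trans (mul_le_mul_of_nonneg_right hKL (D.νq_pos T').le)
  obtain ⟨lo, hlo, l1, l2⟩ := D.exists_comparable hn hL hδ (by linarith) hr2 w g hwg hg0 hga hgν
  obtain ⟨lo', hlo', l1', l2'⟩ := D.exists_comparable hn hL hδ (by linarith) hr2 w (D.q T') hwq
    (D.q_nonneg T') hqa (D.νq_pos T')
  -- the four functionals
  have hq0 := D.q_nonneg w
  have hG0 := D.Q_nonneg w g hg0
  have posR : 0 < (D.R s r (D.Q d (D.q w))).1 D.x :=
    (D.R_pos s (r + (d + w))).trans_le (by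
      rw [D.R_add, ← q_add]
      exact D.R_mono _ _ (D.R_le _ _ _ fun _ => zero_le_one) _)
  have posQ : 0 < (D.Q r (D.Q d (D.q w))).1 D.x := by
    rw [← q_add, ← q_add]; exact D.q_pos _
  have hRQ_mono : ∀ {f f' : boundedMeasurable E}, (∀ y, f.1 y ≤ f'.1 y) →
      (D.R s r (D.Q d f)).1 D.x ≤ (D.R s r (D.Q d f')).1 D.x :=
    fun h => D.R_mono _ _ (D.Q_mono _ h) _
  have hQQ_mono : ∀ {f f' : boundedMeasurable E}, (∀ y, f.1 y ≤ f'.1 y) →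
      (D.Q r (D.Q d f)).1 D.x ≤ (D.Q r (D.Q d f')).1 D.x :=
    fun h => D.Q_mono _ (D.Q_mono _ h) _
  have hRQ_smul : ∀ (a : ℝ) (f : boundedMeasurable E),
      a * (D.R s r (D.Q d f)).1 D.x = (D.R s r (D.Q d (a • f))).1 D.x :=
    fun a f => by rw [map_smul (D.Q d), R_smul]
  have hQQ_smul : ∀ (a : ℝ) (f : boundedMeasurable E),
      a * (D.Q r (D.Q d f)).1 D.x = (D.Q r (D.Q d (a • f))).1 D.x :=
    fun a f => by rw [map_smul (D.Q d), Q_smul]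
  have hb_le : ∀ {a : ℝ} {f f' : boundedMeasurable E}, (∀ y, a * f.1 y ≤ f'.1 y) →
      ∀ y, (a • (b * f)).1 y ≤ (b * f').1 y := fun {a f f'} h y => by
    have := mul_le_mul_of_nonneg_left (h y) (hb0 y)
    change a * (b.1 y * f.1 y) ≤ b.1 y * f'.1 y
    linarith
  have hb_ge : ∀ {a : ℝ} {f f' : boundedMeasurable E}, (∀ y, f'.1 y ≤ a * f.1 y) →
      ∀ y, (b * f').1 y ≤ (a • (b * f)).1 y := fun {a f f'} h y => by
    have := mul_le_mul_of_nonneg_left (h y) (hb0 y)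
    change b.1 y * f'.1 y ≤ a * (b.1 y * f.1 y)
    linarith
  -- replacing the moving boundary by its limit in the window
  have step1 : |(D.R s (r + d) (b * D.R (s + (r + d)) (w + T') 1)).1 D.x /
      (D.R s (r + d + (w + T')) 1).1 D.x -
      (D.R s r (D.Q d (b * D.Q w g))).1 D.x / (D.R s r (D.Q d (D.Q w g))).1 D.x| ≤ 2 * δ := by
    have e1 : D.R s (r + d + (w + T')) 1 =
        D.R s r (D.R (s + r) d (D.R (s + (r + d)) w g)) := by
      rw [D.R_add s (r + d), D.R_add (s + (r + d)) w, D.R_add s r d]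
    rw [e1, D.R_add (s + (r + d)) w, D.R_add s r d, ← hg]
    set h := D.R (s + (r + d)) w g with hh
    have hh0 : ∀ y, 0 ≤ h.1 y := D.R_nonneg _ _ _ hg0
    have hhG : ∀ y, h.1 y ≤ (D.Q w g).1 y := D.R_le _ _ _ hg0
    have hmono : ∀ {c : boundedMeasurable E}, (∀ y, 0 ≤ c.1 y) →
        (D.R s r (D.R (s + r) d (c * h))).1 D.x ≤ (D.R s r (D.Q d (c * D.Q w g))).1 D.x :=
      fun {c} hc0 => D.R_mono _ _ (fun z => (D.R_le _ _ _ (mul_apply_nonneg hc0 hh0) z).trans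
        (D.Q_mono _ (fun y => mul_le_mul_of_nonneg_left (hhG y) (hc0 y)) z)) _
    refine abs_div_sub_div_le_of_loss ?_ (hmono hb0) ?_ ?_ ?_ ?_ hδ1
    · exact D.R_nonneg _ _ _ (D.R_nonneg _ _ _ (mul_apply_nonneg hb0 hh0)) _
    -- The numerator loses no more than the denominator: this is monotonicity for the complementary
    -- test function `1 - b`.
    · have := hmono (c := 1 - b) (fun y => sub_nonneg.2 (hb1 y))
      rw [sub_mul, sub_mul, one_mul, one_mul, map_sub (D.R (s + r) d), map_sub (D.Q d), R_sub,
        R_sub] at this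
      linarith
    · have h1 := hloss r (d + w) (hr.imp_right And.left) (add_le_add hd hw) g hg0 hga ?_
      · rw [D.R_add (s + r) d, D.Q_add, add_assoc s r d] at h1
        exact h1
      -- A full window `w = M` is long enough for the minorization. Otherwise `d + w` may be shorter
      -- than `t₁`, but then `g = 1` and `c ≤ 1` suffices.
      · rcases hwT with rfl | h0
        · rw [← R_smul]
          exact D.R_mono _ _ (D.minor_of_le (hM1.trans (le_add_left' _ _)) g hg0) _
        · have hg1 : g = 1 := by rw [hg, h0, D.R_zero]
          rw [hg1, D.ν_one, mul_one]
          exact mul_le_of_le_one_left (D.R_nonneg _ _ _ (D.q_nonneg _) _) D.c_le_one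
    · exact hRQ_mono (mul_le_of_le_one hb1 hG0)
    · refine lt_of_lt_of_le (mul_pos hlo posR) ?_
      rw [hRQ_smul]
      exact hRQ_mono l1
  -- forgetting the future
  have step2 : |(D.R s r (D.Q d (b * D.Q w g))).1 D.x / (D.R s r (D.Q d (D.Q w g))).1 D.x -
      (D.R s r (D.Q d (b * D.q w))).1 D.x / (D.R s r (D.Q d (D.q w))).1 D.x| ≤ δ := by
    refine abs_div_sub_div_le_of_comparable hlo hδ.le ?_ ?_ ?_ ?_ ?_ ?_ posR
    · rw [hRQ_smul]; exact hRQ_mono (hb_le l1)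
    · rw [hRQ_smul]; exact hRQ_mono (hb_ge l2)
    · rw [hRQ_smul]; exact hRQ_mono l1
    · rw [hRQ_smul]; exact hRQ_mono l2
    · exact D.R_nonneg _ _ _ (D.Q_nonneg _ _ (mul_apply_nonneg hb0 hq0)) _
    · exact hRQ_mono (mul_le_of_le_one hb1 hq0)
  have step4 : |(D.Q r (D.Q d (b * D.Q w (D.q T')))).1 D.x /
      (D.Q r (D.Q d (D.Q w (D.q T')))).1 D.x -
      (D.Q r (D.Q d (b * D.q w))).1 D.x / (D.Q r (D.Q d (D.q w))).1 D.x| ≤ δ := by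
    refine abs_div_sub_div_le_of_comparable hlo' hδ.le ?_ ?_ ?_ ?_ ?_ ?_ posQ
    · rw [hQQ_smul]; exact hQQ_mono (hb_le l1')
    · rw [hQQ_smul]; exact hQQ_mono (hb_ge l2')
    · rw [hQQ_smul]; exact hQQ_mono l1'
    · rw [hQQ_smul]; exact hQQ_mono l2'
    · exact D.Q_nonneg _ _ (D.Q_nonneg _ _ (mul_apply_nonneg hb0 hq0)) _
    · exact hQQ_mono (mul_le_of_le_one hb1 hq0)
  -- forgetting the past
  have step3 : |(D.R s r (D.Q d (b * D.q w))).1 D.x / (D.R s r (D.Q d (D.q w))).1 D.x -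
      (D.Q r (D.Q d (b * D.q w))).1 D.x / (D.Q r (D.Q d (D.q w))).1 D.x| ≤ δ := by
    rcases hr with rfl | ⟨-, hMd⟩
    · rw [D.R_zero, D.R_zero, D.Q_zero, D.Q_zero, sub_self, abs_zero]
      exact hδ.le
    obtain ⟨d', rfl⟩ := D.exists_add _ _ hMd
    have hf0 : ∀ y, 0 ≤ (D.Q d' (b * D.q w)).1 y := D.Q_nonneg _ _ (mul_apply_nonneg hb0 hq0)
    obtain ⟨lo₂, -, m1, m2⟩ := D.exists_ratio 1 (d' + w) _ hf0 (fun y => by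
      rw [one_mul, q_add]
      exact D.Q_mono _ (mul_le_of_le_one hb1 hq0) y) n
    rw [← hM, ← D.Q_add, add_comm M d', ← add_assoc, add_comm M d', q_add] at m1 m2
    rw [mul_one] at m2
    refine (abs_div_sub_div_le_of_mem (lo := lo₂) posR posQ ?_ ?_ ?_ ?_).trans hr3
    · rw [← R_smul]; exact D.R_mono _ _ m1 _
    · rw [← R_smul]; exact D.R_mono _ _ m2 _
    · rw [← Q_smul]; exact D.Q_mono _ m1 _
    · rw [← Q_smul]; exact D.Q_mono _ m2 _
  have e2 : D.q (r + d + (w + T')) = D.Q r (D.Q d (D.Q w (D.q T'))) := by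
    rw [← q_add, ← q_add, ← q_add, add_assoc]
  have e3 : D.Q (r + d) (b * D.q (w + T')) = D.Q r (D.Q d (b * D.Q w (D.q T'))) := by
    rw [D.Q_add, q_add]
  rw [e2, e3]
  rw [abs_le] at *
  constructor <;> linarith [step1.1, step1.2, step2.1, step2.2, step3.1, step3.2, step4.1, step4.2]

end KilledPair

/-! ### Killed Markov processes as operators. -/

variable {I : AddSubmonoid ℝ≥0} {E : Type*} [MeasurableSpace E] {Ω : Type*} [MeasurableSpace Ω]

lemma integrable_comp (f : boundedMeasurable E) {Ω' : Type*} [MeasurableSpace Ω']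
    (μ : Measure Ω') [IsFiniteMeasure μ] {g : Ω' → E} (hg : Measurable g) :
    Integrable (fun ω => f.1 (g ω)) μ := by
  obtain ⟨hf, K, hK⟩ := f.2
  exact Integrable.of_bound (hf.comp hg).aestronglyMeasurable K (ae_of_all _ fun ω => hK _)

lemma IsTimeSet.exists_add (hI : IsTimeSet I) (a b : I) (h : a ≤ b) : ∃ d, b = d + a := by
  have hab : (a : ℝ≥0) ≤ b := h
  rcases hI with rfl | rfl
  · obtain ⟨_, m, rfl⟩ := a
    obtain ⟨_, n, rfl⟩ := b
    have hmn : m ≤ n := by simpa using hab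
    refine ⟨⟨_, n - m, rfl⟩, Subtype.ext ?_⟩
    simp [tsub_add_cancel_of_le (show (m : ℝ≥0) ≤ n from mod_cast hmn)]
  · exact ⟨⟨b - a, trivial⟩, Subtype.ext (tsub_add_cancel_of_le hab).symm⟩

lemma IsTimeSet.one_mem (hI : IsTimeSet I) : (1 : ℝ≥0) ∈ I := by
  rcases hI with rfl | rfl
  · exact ⟨1, by simp⟩
  · trivial

lemma IsTimeSet.isCompact_Iic (hI : IsTimeSet I) (V : I) : IsCompact (Set.Iic V) := by
  rcases hI with rfl | rfl
  · refine Set.Finite.isCompact ?_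
    obtain ⟨_, n, rfl⟩ := V
    refine ((Set.finite_Iic n).image fun m : ℕ =>
      (⟨_, m, rfl⟩ : AddMonoidHom.mrange (Nat.castAddMonoidHom ℝ≥0))).subset ?_
    rintro ⟨_, m, rfl⟩ hm
    refine ⟨m, ?_, rfl⟩
    have : (m : ℝ≥0) ≤ n := hm
    exact_mod_cast this
  · rw [Subtype.isCompact_iff]
    have : Subtype.val '' Set.Iic V = Set.Icc (0 : ℝ≥0) V := by
      ext a
      constructor
      · rintro ⟨b, hb, rfl⟩
        exact ⟨zero_le, hb⟩
      · exact fun ha => ⟨⟨a, trivial⟩, ha.2, rfl⟩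
    rw [this]
    exact isCompact_Icc

namespace MarkovFamily
variable (M : MarkovFamily I E Ω)

/-- The event `{τ_B ≥ t}`. -/
def alive (B : I → Set E) (t : I) : Set Ω := {ω | ((t : ℝ≥0) : ℝ≥0∞) ≤ M.hit B ω}

/-- The hitting time of `B` is an optional time of the natural filtration. -/
def IsOptional (B : I → Set E) : Prop :=
  ∀ t : I, MeasurableSet[M.filtration t] {ω | M.hit B ω < ((t : ℝ≥0) : ℝ≥0∞)}

variable {M}

lemma mem_alive {B : I → Set E} {t : I} {ω : Ω} :
    ω ∈ M.alive B t ↔ ∀ v, M.X v ω ∈ B v → t ≤ v := by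
  simp only [alive, hit, Set.mem_ofPred_eq, le_sInf_iff, Set.forall_mem_image]
  exact forall₂_congr fun v _ => ENNReal.coe_le_coe

lemma IsOptional.measurableSet_filtration {B : I → Set E} (hB : M.IsOptional B) (t : I) :
    MeasurableSet[M.filtration t] (M.alive B t) := by
  have : M.alive B t = {ω | M.hit B ω < ((t : ℝ≥0) : ℝ≥0∞)}ᶜ := by
    ext ω; simp [alive]
  rw [this]
  exact (hB t).compl

lemma IsOptional.measurableSet {B : I → Set E} (hB : M.IsOptional B) (t : I) :
    MeasurableSet (M.alive B t) :=
  M.filtration.le t _ (hB.measurableSet_filtration t)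

lemma alive_mono_set {B B' : I → Set E} (h : ∀ v, B v ⊆ B' v) (t : I) :
    M.alive B' t ⊆ M.alive B t :=
  fun _ hω => mem_alive.2 fun v hv => mem_alive.1 hω v (h v hv)

lemma survive_subset_alive (B : I → Set E) (t : I) : M.survive B t ⊆ M.alive B t :=
  fun ω h => (show ((t : ℝ≥0) : ℝ≥0∞) < M.hit B ω from h).le

lemma alive_subset_survive (B : I → Set E) {t u : I} (h : t < u) :
    M.alive B u ⊆ M.survive B t :=
  fun _ hω => lt_of_lt_of_le (ENNReal.coe_lt_coe.2 h) hω

lemma alive_zero (B : I → Set E) : M.alive B 0 = Set.univ :=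
  Set.eq_univ_of_forall fun ω => by simp [alive]

lemma measurable_path (M : MarkovFamily I E Ω) : Measurable fun ω t => M.X t ω :=
  measurable_pi_lambda _ M.measurable_X

lemma measurable_shifted_path (M : MarkovFamily I E Ω) (r : I) :
    Measurable fun ω t => M.X (r + t) ω :=
  measurable_pi_lambda _ fun t => M.measurable_X (r + t)

lemma IsOptional.exists_path_set {B : I → Set E} (hB : M.IsOptional B) (t : I) :
    ∃ C : Set (I → E), MeasurableSet C ∧ (fun ω v => M.X v ω) ⁻¹' C = M.alive B t := by
  have h : M.filtration t ≤ MeasurableSpace.comap (fun ω v => M.X v ω) MeasurableSpace.pi := by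
    refine iSup₂_le fun v _ => ?_
    have : M.X v = (fun p : I → E => p v) ∘ fun ω v => M.X v ω := rfl
    rw [this, ← MeasurableSpace.comap_comp]
    exact MeasurableSpace.comap_mono (measurable_pi_apply v).comap_le
  exact MeasurableSpace.measurableSet_comap.1 (h _ (hB.measurableSet_filtration t))

/-- The Markov property in integral form, on the event that the shifted path avoids `B`. -/
lemma setIntegral_shift (B : I → Set E) (hB : M.IsOptional B) (r u : I) (y : E)
    {G : Set Ω} (hG : MeasurableSet[M.filtration r] G) (f : boundedMeasurable E) :
    ∫ ω in G ∩ {ω | ∀ v, M.X (r + v) ω ∈ B v → u ≤ v}, f.1 (M.X (r + u) ω) ∂M.P y =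
      ∫ ω in G, ∫ ω' in M.alive B u, f.1 (M.X u ω') ∂M.P (M.X r ω) ∂M.P y := by
  obtain ⟨C, hC, hCB⟩ := hB.exists_path_set u
  -- `C` is determined only on trajectories of the process, so the shifted path must itself be one;
  -- stability under shifts provides this.
  have hset : {ω | ∀ v, M.X (r + v) ω ∈ B v → u ≤ v} = (fun ω t => M.X (r + t) ω) ⁻¹' C := by
    ext ω
    obtain ⟨ω', hω'⟩ := M.shift r ω
    have h1 : ω' ∈ M.alive B u ↔ (fun t => M.X t ω') ∈ C := by rw [← hCB]; rfl
    rw [mem_alive] at h1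
    simp only [hω'] at h1
    exact h1
  set F : (I → E) → ℝ := C.indicator fun p => f.1 (p u) with hF
  obtain ⟨hf, K, hK⟩ := f.2
  have hFm : Measurable F := (hf.comp (measurable_pi_apply u)).indicator hC
  have hFb : ∀ p, ‖F p‖ ≤ K := fun p =>
    (norm_indicator_le_norm_self _ _).trans (hK _)
  set κ : Kernel E (I → E) := M.P.map fun ω t => M.X t ω with hκ
  have : IsMarkovKernel κ := Kernel.IsMarkovKernel.map _ M.measurable_path
  have hmeas : ((M.P y).restrict G).map (fun ω t => M.X (r + t) ω) =
      (((M.P y).restrict G).map (M.X r)).bind κ := by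
    ext D hD
    rw [Measure.map_apply (M.measurable_shifted_path r) hD,
      Measure.restrict_apply (M.measurable_shifted_path r hD),
      Measure.bind_apply hD κ.aemeasurable, lintegral_map (κ.measurable_coe hD)
      (M.measurable_X r), Set.inter_comm]
    refine (M.markov r y D hD G hG).trans (lintegral_congr fun ω => ?_)
    rw [hκ, Kernel.map_apply' _ M.measurable_path _ hD]
    rfl
  rw [hset]
  have hl : ∫ ω in G ∩ (fun ω t => M.X (r + t) ω) ⁻¹' C, f.1 (M.X (r + u) ω) ∂M.P y =
      ∫ p, F p ∂((M.P y).restrict G).map (fun ω t => M.X (r + t) ω) := by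
    rw [integral_map (M.measurable_shifted_path r).aemeasurable hFm.aestronglyMeasurable,
      Set.inter_comm, ← Measure.restrict_restrict (M.measurable_shifted_path r hC),
      ← integral_indicator (M.measurable_shifted_path r hC)]
    rfl
  have hcomp := Kernel.integral_comp (κ := Kernel.const Unit (((M.P y).restrict G).map (M.X r)))
    (η := κ) (a := ()) (f := F) (Integrable.of_bound hFm.aestronglyMeasurable K
      (ae_of_all _ hFb))
  rw [Kernel.comp_apply, Kernel.const_apply] at hcomp
  rw [hl, hmeas, hcomp, integral_map (M.measurable_X r).aemeasurable
    hFm.stronglyMeasurable.integral_kernel.aestronglyMeasurable]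
  refine integral_congr_ae (ae_of_all _ fun ω => ?_)
  change ∫ p, F p ∂κ (M.X r ω) = ∫ ω' in M.alive B u, f.1 (M.X u ω') ∂M.P (M.X r ω)
  rw [hκ, Kernel.map_apply _ M.measurable_path,
    integral_map M.measurable_path.aemeasurable hFm.aestronglyMeasurable, ← hCB,
    ← integral_indicator (M.measurable_path hC)]
  rfl

lemma alive_add (hI : IsTimeSet I) (B : I → Set E) (r u : I) :
    M.alive B (r + u) = M.alive B r ∩ {ω | ∀ v, M.X (r + v) ω ∈ shifted B r v → u ≤ v} := by
  ext ω
  simp only [Set.mem_inter_iff, mem_alive, Set.mem_ofPred_eq, shifted]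
  constructor
  · exact fun h => ⟨fun v hv => (KilledPair.le_add_right' r u).trans (h v hv),
      fun v hv => le_of_add_le_add_left (h _ hv)⟩
  · rintro ⟨h1, h2⟩ v hv
    obtain ⟨d, rfl⟩ := hI.exists_add _ _ (h1 v hv)
    rw [add_comm d r] at hv ⊢
    exact add_le_add_right (h2 d hv) r

/-- The operator `f ↦ E_y[f(X_r); τ_B ≥ r]`. -/
noncomputable def killedOp {B : I → Set E} (hB : M.IsOptional B) (r : I) :
    boundedMeasurable E →ₗ[ℝ] boundedMeasurable E where
  toFun f := ⟨fun y => ∫ ω in M.alive B r, f.1 (M.X r ω) ∂M.P y, by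
    obtain ⟨hf, K, hK⟩ := f.2
    constructor
    · simp_rw [← integral_indicator (hB.measurableSet r)]
      exact (((hf.comp (M.measurable_X r)).indicator
        (hB.measurableSet r)).stronglyMeasurable.integral_kernel).measurable
    · refine ⟨K, fun y => ?_⟩
      refine (norm_integral_le_of_norm_le_const (f := fun ω => f.1 (M.X r ω)) (C := K)
         (ae_of_all _ fun ω => hK _)).trans ?_
      have hK0 : 0 ≤ K := (abs_nonneg _).trans (hK y)
      refine mul_le_of_le_one_right hK0 ?_
      rw [measureReal_restrict_apply_univ]
      exact measureReal_le_one⟩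
  map_add' f g := Subtype.ext (funext fun y =>
    integral_add (integrable_comp f _ (M.measurable_X r)) (integrable_comp g _ (M.measurable_X r)))
  map_smul' a f := Subtype.ext (funext fun y => integral_const_mul a _)

lemma killedOp_apply {B : I → Set E} (hB : M.IsOptional B) (r : I) (f : boundedMeasurable E)
    (y : E) : (killedOp hB r f).1 y = ∫ ω in M.alive B r, f.1 (M.X r ω) ∂M.P y := rfl

lemma killedOp_one {B : I → Set E} (hB : M.IsOptional B) (r : I) (y : E) :
    (killedOp hB r 1).1 y = (M.P y).real (M.alive B r) := by
  rw [killedOp_apply]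
  change ∫ _ in M.alive B r, (1 : ℝ) ∂M.P y = _
  simp

lemma killedOp_add (hI : IsTimeSet I) {B B' : I → Set E} (hB : M.IsOptional B)
    (hB' : M.IsOptional B') (r u : I) (h : shifted B r = B') (f : boundedMeasurable E) :
    killedOp hB (r + u) f = killedOp hB r (killedOp hB' u f) := by
  subst h
  refine Subtype.ext (funext fun y => ?_)
  rw [killedOp_apply, alive_add hI,
    setIntegral_shift _ hB' r u y (hB.measurableSet_filtration r) f]
  rfl

lemma killedOp_zero {B : I → Set E} (hB : M.IsOptional B) (f : boundedMeasurable E) :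
    killedOp hB 0 f = f := by
  refine Subtype.ext (funext fun y => ?_)
  rw [killedOp_apply, alive_zero, Measure.restrict_univ,
    integral_congr_ae ((M.start y).mono fun ω hω => by rw [hω])]
  simp

lemma killedOp_nonneg {B : I → Set E} (hB : M.IsOptional B) (r : I) (f : boundedMeasurable E)
    (hf : ∀ y, 0 ≤ f.1 y) (y : E) : 0 ≤ (killedOp hB r f).1 y :=
  integral_nonneg fun _ => hf _

lemma killedOp_le {B B' : I → Set E} (hB : M.IsOptional B) (hB' : M.IsOptional B')
    (h : ∀ v, B v ⊆ B' v) (r : I) (f : boundedMeasurable E) (hf : ∀ y, 0 ≤ f.1 y) (y : E) :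
    (killedOp hB' r f).1 y ≤ (killedOp hB r f).1 y :=
  setIntegral_mono_set (integrable_comp f _ (M.measurable_X r)) (ae_of_all _ fun _ => hf _)
    (alive_mono_set h r).eventuallyLE

/-- The indicator function of a measurable set. -/
noncomputable def indicatorOne {b : Set E} (hb : MeasurableSet b) : boundedMeasurable E :=
  ⟨b.indicator 1, measurable_one.indicator hb, 1, fun y => by
    by_cases h : y ∈ b <;> simp [h]⟩

/-- The Markov property at time `t` on `{τ ≥ t, X_t ∈ b}`; it gives the numerators of the
conditioned laws. -/
lemma real_alive_inter (hI : IsTimeSet I) {B B' : I → Set E} (hB : M.IsOptional B)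
    (hB' : M.IsOptional B') (t T : I) (h : shifted B t = B') {b : Set E} (hb : MeasurableSet b)
    (y : E) : (M.P y).real (M.alive B (t + T) ∩ M.X t ⁻¹' b) =
      (killedOp hB t (indicatorOne hb * killedOp hB' T 1)).1 y := by
  subst h
  have hXb : MeasurableSet[M.filtration t] (M.X t ⁻¹' b) :=
    (le_iSup₂_of_le (f := fun v (_ : v ≤ t) => MeasurableSpace.comap (M.X v) inferInstance)
      t le_rfl le_rfl) _ ⟨b, hb, rfl⟩
  have h1 := setIntegral_shift _ hB' t T y ((hB.measurableSet_filtration t).inter hXb) 1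
  rw [killedOp_apply, alive_add hI, Set.inter_right_comm]
  have h2 : ∀ S : Set Ω, ∫ ω in S, (1 : boundedMeasurable E).1 (M.X (t + T) ω) ∂M.P y =
      (M.P y).real S := fun S => by
    change ∫ _ in S, (1 : ℝ) ∂M.P y = _
    simp
  rw [h2] at h1
  rw [h1, Set.inter_comm, ← Measure.restrict_restrict (M.measurable_X t hb),
    ← integral_indicator (M.measurable_X t hb)]
  refine integral_congr_ae (ae_of_all _ fun ω => ?_)
  change _ = b.indicator (1 : E → ℝ) (M.X t ω) * (killedOp hB' T 1).1 (M.X t ω)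
  by_cases hω : M.X t ω ∈ b
  · rw [Set.indicator_of_mem (show ω ∈ M.X t ⁻¹' b from hω), Set.indicator_of_mem hω,
      Pi.one_apply, one_mul]
    rfl
  · rw [Set.indicator_of_notMem (show ω ∉ M.X t ⁻¹' b from hω), Set.indicator_of_notMem hω,
      zero_mul]

end MarkovFamily

/-! ### Strict versus weak survival, and convergence of survival probabilities. -/

lemma limitSet_subset {I : AddSubmonoid ℝ≥0} {E : Type*} (A : I → Set E) (t : I) : limitSet A ⊆ A t := Set.iInter_subset A t

lemma limitBoundary_subset {I : AddSubmonoid ℝ≥0} {E : Type*} (A : I → Set E) (s v : I) :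
    limitBoundary A v ⊆ shifted A s v :=
  limitSet_subset A _

lemma shifted_shifted {I : AddSubmonoid ℝ≥0} {E : Type*} (A : I → Set E) (s r : I) :
    shifted (shifted A s) r = shifted A (s + r) := funext fun t => by
  simp only [shifted, add_assoc]

namespace MarkovFamily
variable {M : MarkovFamily I E Ω}

lemma survive_mono_set {B B' : I → Set E} (h : ∀ v, B v ⊆ B' v) (t : I) :
    M.survive B' t ⊆ M.survive B t := fun ω hω =>
  lt_of_lt_of_le (show ((t : ℝ≥0) : ℝ≥0∞) < M.hit B' ω from hω)
    (sInf_le_sInf (Set.image_mono fun v hv => h v hv))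

/-- `{τ ≥ v}` is contained in `{τ > a}` for every `a < v`; let `a` increase to `v`. -/
lemma real_alive_eq_real_survive (hI : I = ⊤) {B : I → Set E} {x : E}
    (hc : Continuous fun t : I => (M.P x).real (M.survive B t)) {v : I} (hv : 0 < v) :
    (M.P x).real (M.alive B v) = (M.P x).real (M.survive B v) := by
  refine le_antisymm ?_ (measureReal_mono (survive_subset_alive B v))
  subst hI
  have hne : (𝓝[<] (v : ℝ≥0)).NeBot := nhdsLT_neBot_of_exists_lt ⟨0, hv⟩
  have hg : Continuous fun a : ℝ≥0 =>
      (M.P x).real (M.survive B (⟨a, trivial⟩ : (⊤ : AddSubmonoid ℝ≥0))) :=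
    hc.comp (Continuous.subtype_mk continuous_id _)
  refine ge_of_tendsto ((hg.tendsto v.1).mono_left (nhdsWithin_le_nhds (s := Set.Iio v.1))) ?_
  filter_upwards [self_mem_nhdsWithin] with a ha
  exact measureReal_mono (alive_subset_survive B
    (show (⟨a, trivial⟩ : (⊤ : AddSubmonoid ℝ≥0)) < v from ha))

lemma survive_eq_alive_add_one
    {M : MarkovFamily (AddMonoidHom.mrange (Nat.castAddMonoidHom ℝ≥0)) E Ω}
    (B : (AddMonoidHom.mrange (Nat.castAddMonoidHom ℝ≥0)) → Set E)
    (u : AddMonoidHom.mrange (Nat.castAddMonoidHom ℝ≥0)) :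
    M.survive B u = M.alive B (u + ⟨1, 1, Nat.cast_one⟩) := by
  refine Set.Subset.antisymm (fun ω hω => mem_alive.2 fun v hv => ?_)
    (alive_subset_survive B (lt_add_of_pos_right u (show (0 : ℝ≥0) < 1 from one_pos)))
  have h1 : ((u : ℝ≥0) : ℝ≥0∞) < ((v : ℝ≥0) : ℝ≥0∞) :=
    lt_of_lt_of_le (show ((u : ℝ≥0) : ℝ≥0∞) < M.hit B ω from hω) (sInf_le ⟨v, hv, rfl⟩)
  obtain ⟨_, m, rfl⟩ := u
  obtain ⟨_, n, rfl⟩ := v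
  have h2 : m < n := by simpa using h1
  have h3 : ((m : ℝ≥0) + 1) ≤ n := by exact_mod_cast h2
  exact h3

end MarkovFamily

open MarkovFamily

lemma Standing.shifted_subset {M : MarkovFamily I E Ω} {A : I → Set E} (hA : Standing M A)
    {s s' : I} (h : s ≤ s') (v : I) : shifted A s' v ⊆ shifted A s v :=
  hA.antitone (add_le_add_left h v)

/-- The portmanteau theorem on the open set `(v, ∞]` bounds the liminf from below; the inclusion of
`A_∞` in the moving boundary bounds every term from above. -/
lemma Regularity.tendsto_survive [TopologicalSpace E] {M : MarkovFamily I E Ω} {A : I → Set E}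
    (hReg : Regularity M A) {x : E} (hx : x ∉ A 0) (v : I) :
    Tendsto (fun s : I => (M.P x).real (M.survive (shifted A s) v)) atTop
      (𝓝 ((M.P x).real (M.survive (limitBoundary A) v))) := by
  have hd := hReg.tendsto_hit x hx
  have hlim := ProbabilityMeasure.le_liminf_measure_open_of_tendsto hd.tendsto
    (G := Set.Ioi ((v : ℝ≥0) : ℝ≥0∞)) isOpen_Ioi
  simp only [ProbabilityMeasure.coe_mk] at hlim
  rw [Measure.map_apply_of_aemeasurable hd.aemeasurable_limit measurableSet_Ioi] at hlim
  have e : ∀ s : I, ((M.P x).map (M.hit (shifted A s))) (Set.Ioi ((v : ℝ≥0) : ℝ≥0∞)) =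
      M.P x (M.survive (shifted A s) v) := fun s =>
    Measure.map_apply_of_aemeasurable (hd.forall_aemeasurable s) measurableSet_Ioi
  simp only [e] at hlim
  have hle : ∀ s : I, M.P x (M.survive (shifted A s) v) ≤
      M.P x (M.survive (limitBoundary A) v) := fun s =>
    measure_mono (survive_mono_set (limitBoundary_subset A s) v)
  have ht : Tendsto (fun s : I => M.P x (M.survive (shifted A s) v)) atTop
      (𝓝 (M.P x (M.survive (limitBoundary A) v))) :=
    tendsto_of_le_liminf_of_limsup_le hlim
      (limsup_le_of_le (by isBoundedDefault) (Eventually.of_forall hle))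
  exact (ENNReal.tendsto_toReal (measure_ne_top _ _)).comp ht

/-- The survival probabilities converge locally uniformly in time. -/
lemma Regularity.eventually_survive_sub_le [TopologicalSpace E] {M : MarkovFamily I E Ω}
    {A : I → Set E} (hReg : Regularity M A) (hI : IsTimeSet I) (hA : Standing M A) {x : E}
    (hx : x ∉ A 0) (V : I) {δ : ℝ} (hδ : 0 < δ) :
    ∀ᶠ s in atTop, ∀ v ≤ V, (M.P x).real (M.survive (limitBoundary A) v) -
      (M.P x).real (M.survive (shifted A s) v) ≤ δ := by
  -- Dini's theorem: the functions are continuous in time, increase with `s` since `A` shrinks, and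
  -- have a continuous limit.
  have h := Monotone.tendstoUniformlyOn_of_forall_tendsto (hI.isCompact_Iic V)
    (F := fun s v : I => (M.P x).real (M.survive (shifted A s) v))
    (fun s => (hReg.continuous_time x hx s).continuousOn)
    (fun v _ s s' hs => measureReal_mono (survive_mono_set (hA.shifted_subset hs) v))
    (hReg.continuous_time_limit x hx).continuousOn (fun v _ => hReg.tendsto_survive hx v)
  filter_upwards [Metric.tendstoUniformlyOn_iff.1 h δ hδ] with s hs v hv
  exact (le_abs_self _).trans (hs v hv).le

lemma Regularity.eventually_alive_sub_le [TopologicalSpace E] {M : MarkovFamily I E Ω}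
    {A : I → Set E} (hReg : Regularity M A) (hI : IsTimeSet I) (hA : Standing M A) {x : E}
    (hx : x ∉ A 0) (V : I) {δ : ℝ} (hδ : 0 < δ) :
    ∀ᶠ s in atTop, ∀ v ≤ V, (M.P x).real (M.alive (limitBoundary A) v) -
      (M.P x).real (M.alive (shifted A s) v) ≤ δ := by
  filter_upwards [hReg.eventually_survive_sub_le hI hA hx V hδ] with s hs v hv
  rcases eq_or_ne v 0 with rfl | hv0
  · rw [alive_zero, alive_zero, sub_self]; exact hδ.le
  have hv0' : (0 : ℝ≥0) < v := pos_iff_ne_zero.2 fun h => hv0 (Subtype.ext h)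
  rcases id hI with rfl | htop
  · obtain ⟨_, n, rfl⟩ := v
    obtain ⟨m, rfl⟩ : ∃ m, n = m + 1 := Nat.exists_eq_succ_of_ne_zero (by
      rintro rfl
      exact hv0 (Subtype.ext (by simp)))
    have e : (⟨_, m + 1, rfl⟩ : AddMonoidHom.mrange (Nat.castAddMonoidHom ℝ≥0)) =
        ⟨_, m, rfl⟩ + ⟨1, 1, Nat.cast_one⟩ := Subtype.ext (by simp)
    rw [e, ← survive_eq_alive_add_one, ← survive_eq_alive_add_one]
    refine hs _ (le_trans ?_ hv)
    rw [e]
    exact KilledPair.le_add_right' _ _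
  · rw [real_alive_eq_real_survive htop (hReg.continuous_time_limit x hx) hv0',
      real_alive_eq_real_survive htop (hReg.continuous_time x hx s) hv0']
    exact hs v hv

/-! ### From the Champagnat-Villemonais conditions to a `KilledPair`. -/

variable {M : MarkovFamily I E Ω} {A : I → Set E}

lemma Standing.isOptional_shifted (hA : Standing M A) (s : I) : M.IsOptional (shifted A s) :=
  hA.optional_shifted s

lemma Standing.isOptional_limit (hA : Standing M A) : M.IsOptional (limitBoundary A) :=
  hA.optional_limit

lemma killedOp_limit_eq_zero (h : M.IsOptional (limitBoundary A)) {t : I} (ht : 0 < t) {y : E}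
    (hy : y ∈ limitSet A) : (killedOp h t 1).1 y = 0 := by
  rw [killedOp_one, measureReal_eq_zero_iff]
  refine measure_mono_null ?_ (ae_iff.1 (M.start y))
  intro ω hω h0
  have := mem_alive.1 hω 0 (by rw [h0]; exact hy)
  exact absurd ht (not_lt.2 this)

lemma real_survive_pos (hA : Standing M A) (s t : I) {y : E} (hy : y ∉ A s) :
    0 < (M.P y).real (M.survive (shifted A s) t) :=
  ENNReal.toReal_pos (hA.survive_pos s t y hy).ne' (measure_ne_top _ _)

/-- The event `{τ > t₀}` lies between `{τ ≥ t₀ + e}` and `{τ ≥ t₀}`, hence the time gap `e`. On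
`A_∞` the left side vanishes because `t₀ + e > 0`. -/
lemma le_killedOp_of_le_condLaw (h : M.IsOptional (limitBoundary A)) {ν : Measure E}
    [IsProbabilityMeasure ν] {t₀ e : I} (he : 0 < e) {c₁ : ℝ≥0}
    (hc : ∀ x ∉ limitSet A, c₁ • ν ≤ M.condLaw (limitBoundary A) x t₀ t₀)
    (f : boundedMeasurable E) (hf : ∀ y, 0 ≤ f.1 y) (y : E) :
    c₁ * (∫ z, f.1 z ∂ν) * (killedOp h (t₀ + e) 1).1 y ≤ (killedOp h t₀ f).1 y := by
  have het : 0 < t₀ + e := lt_of_lt_of_le he (KilledPair.le_add_left' _ _)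
  by_cases hy : y ∈ limitSet A
  · rw [killedOp_limit_eq_zero h het hy, mul_zero]
    exact killedOp_nonneg h t₀ f hf y
  set S := M.survive (limitBoundary A) t₀ with hS
  have h1 : (c₁ : ℝ) * (∫ z, f.1 z ∂ν) * (M.P y).real S ≤ ∫ ω in S, f.1 (M.X t₀ ω) ∂M.P y := by
    by_cases hS0 : M.P y S = 0
    · rw [measureReal_def, hS0, ENNReal.toReal_zero, mul_zero]
      exact integral_nonneg fun _ => hf _
    have : IsProbabilityMeasure ((M.P y)[|S]) := cond_isProbabilityMeasure hS0
    have : IsProbabilityMeasure (M.condLaw (limitBoundary A) y t₀ t₀) :=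
      Measure.isProbabilityMeasure_map (M.measurable_X t₀).aemeasurable
    have h2 := integral_mono_measure (hc y hy) (ae_of_all _ hf)
      (integrable_comp f (M.condLaw (limitBoundary A) y t₀ t₀) measurable_id)
    rw [integral_smul_nnreal_measure, condLaw, integral_map (M.measurable_X t₀).aemeasurable
      f.2.1.aestronglyMeasurable, ProbabilityTheory.cond, integral_smul_measure,
      ENNReal.toReal_inv] at h2
    change (c₁ : ℝ) * _ ≤ ((M.P y).real S)⁻¹ * _ at h2
    have hp : 0 < (M.P y).real S := ENNReal.toReal_pos hS0 (measure_ne_top _ _)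
    rw [inv_mul_eq_div, le_div_iff₀ hp] at h2
    exact h2
  have h3 : (killedOp h (t₀ + e) 1).1 y ≤ (M.P y).real S := by
    rw [killedOp_one]
    exact measureReal_mono (alive_subset_survive _ (lt_add_of_pos_right t₀ he))
  have h4 : ∫ ω in S, f.1 (M.X t₀ ω) ∂M.P y ≤ (killedOp h t₀ f).1 y :=
    setIntegral_mono_set (integrable_comp f _ (M.measurable_X t₀)) (ae_of_all _ fun _ => hf _)
      (survive_subset_alive _ t₀).eventuallyLE
  refine (mul_le_mul_of_nonneg_left h3 ?_).trans (h1.trans h4)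
  exact mul_nonneg c₁.2 (integral_nonneg hf)

lemma mul_survive_le_integral (h : M.IsOptional (limitBoundary A)) {ν : Measure E}
    [IsProbabilityMeasure ν] {c₂ : ℝ≥0} {t : I} {y : E}
    (hc : (c₂ : ℝ≥0∞) * M.P y (M.survive (limitBoundary A) t) ≤
      (M.P ∘ₘ ν) (M.survive (limitBoundary A) t)) :
    c₂ * (M.P y).real (M.survive (limitBoundary A) t) ≤ ∫ z, (killedOp h t 1).1 z ∂ν := by
  have h1 := hc.trans (measure_mono (survive_subset_alive _ t))
  rw [Measure.bind_apply (h.measurableSet t) M.P.aemeasurable] at h1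
  have h2 : ∫ z, (killedOp h t 1).1 z ∂ν =
      (∫⁻ z, M.P z (M.alive (limitBoundary A) t) ∂ν).toReal := by
    rw [← integral_toReal (M.P.measurable_coe (h.measurableSet t)).aemeasurable
      (ae_of_all _ fun _ => measure_lt_top _ _)]
    exact integral_congr_ae (ae_of_all _ fun z => killedOp_one h t z)
  rw [h2]
  have h3 : ∫⁻ z, M.P z (M.alive (limitBoundary A) t) ∂ν ≠ ∞ := by
    refine ne_top_of_le_ne_top ENNReal.one_ne_top ?_
    refine (lintegral_mono fun z => prob_le_one).trans ?_
    simp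
  have h4 := ENNReal.toReal_mono h3 h1
  rwa [ENNReal.toReal_mul] at h4

/-- Using the gapped minorization twice, with a time `e` in between, closes the gap: the second use
bounds `ν(Q_{e+t₀} f)` below by a multiple of `ν(f)`. -/
lemma exists_minor (hI : IsTimeSet I) (h : M.IsOptional (limitBoundary A)) {ν : Measure E}
    [IsProbabilityMeasure ν] {t₀ : I} {c₁ : ℝ≥0} (hc₁ : 0 < c₁)
    (hc : ∀ x ∉ limitSet A, c₁ • ν ≤ M.condLaw (limitBoundary A) x t₀ t₀)
    (hpos : ∀ t, 0 < ∫ z, (killedOp h t 1).1 z ∂ν) (e : I) (he : 0 < e) :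
    ∃ t₁ : I, e ≤ t₁ ∧ ∃ c : ℝ, 0 < c ∧ ∀ f : boundedMeasurable E, (∀ y, 0 ≤ f.1 y) →
      ∀ y, c * (killedOp h t₁ 1).1 y * ∫ z, f.1 z ∂ν ≤ (killedOp h t₁ f).1 y := by
  have hmono : ∀ (r : I) {f g : boundedMeasurable E}, (∀ y, f.1 y ≤ g.1 y) → ∀ y,
      (killedOp h r f).1 y ≤ (killedOp h r g).1 y := fun r f g hfg y => by
    have := killedOp_nonneg h r (g - f) (fun z => sub_nonneg.2 (hfg z)) y
    rw [map_sub] at this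
    exact sub_nonneg.1 this
  have hadd : ∀ r u f, killedOp h (r + u) f = killedOp h r (killedOp h u f) :=
    fun r u f => killedOp_add hI h h r u rfl f
  have key := le_killedOp_of_le_condLaw h he hc
  refine ⟨t₀ + (e + t₀), (KilledPair.le_add_right' e t₀).trans (KilledPair.le_add_left' _ _),
    c₁ * c₁ * ∫ z, (killedOp h (e + (t₀ + e)) 1).1 z ∂ν, ?_, fun f hf y => ?_⟩
  · have := hpos (e + (t₀ + e))
    have := NNReal.coe_pos.2 hc₁
    positivity
  have hν : 0 ≤ ∫ z, f.1 z ∂ν := integral_nonneg hf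
  have h1 : ∀ z, c₁ * (∫ z, f.1 z ∂ν) * (killedOp h (e + (t₀ + e)) 1).1 z ≤
      (killedOp h (e + t₀) f).1 z := fun z => by
    rw [hadd e t₀ f, hadd e (t₀ + e) 1]
    have := hmono e (f := ((c₁ : ℝ) * ∫ z, f.1 z ∂ν) • killedOp h (t₀ + e) 1)
      (g := killedOp h t₀ f) (key f hf) z
    rw [map_smul] at this
    exact this
  have h2 : c₁ * (∫ z, f.1 z ∂ν) * (∫ z, (killedOp h (e + (t₀ + e)) 1).1 z ∂ν) ≤
      ∫ z, (killedOp h (e + t₀) f).1 z ∂ν := by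
    rw [← integral_const_mul]
    exact integral_mono ((integrable_comp _ ν measurable_id).const_mul _)
      (integrable_comp _ ν measurable_id) h1
  have h3 := key (killedOp h (e + t₀) f) (killedOp_nonneg h _ f hf) y
  have h4 : (killedOp h (t₀ + (e + t₀)) 1).1 y ≤ (killedOp h (t₀ + e) 1).1 y := by
    rw [← add_assoc, hadd]
    refine hmono _ (fun z => ?_) y
    rw [killedOp_one]
    exact measureReal_le_one
  rw [hadd t₀ (e + t₀) f]
  have h5 : 0 ≤ (killedOp h (t₀ + e) 1).1 y := killedOp_nonneg h _ 1 (fun _ => zero_le_one) y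
  have hc0 : (0 : ℝ) ≤ c₁ := c₁.2
  have h6 : 0 ≤ ∫ z, (killedOp h (e + (t₀ + e)) 1).1 z ∂ν := (hpos _).le
  calc _ ≤ c₁ * c₁ * (∫ z, (killedOp h (e + (t₀ + e)) 1).1 z ∂ν) *
        (killedOp h (t₀ + e) 1).1 y * ∫ z, f.1 z ∂ν := by gcongr
    _ = c₁ * (c₁ * (∫ z, f.1 z ∂ν) * (∫ z, (killedOp h (e + (t₀ + e)) 1).1 z ∂ν)) *
        (killedOp h (t₀ + e) 1).1 y := by ring
    _ ≤ c₁ * (∫ z, (killedOp h (e + t₀) f).1 z ∂ν) * (killedOp h (t₀ + e) 1).1 y := by gcongr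
    _ ≤ _ := h3

lemma exists_killedPair [TopologicalSpace E] (hI : IsTimeSet I) (hA : Standing M A)
    (hReg : Regularity M A) (hCV : LimitCV M A) {x : E} (hx : x ∉ A 0) :
    ∃ D : KilledPair I E, D.x = x ∧ (∀ s, D.R s = killedOp (hA.isOptional_shifted s)) ∧
      D.Q = killedOp hA.isOptional_limit := by
  obtain ⟨ν, hν, -, ⟨t₀, c₁, hc₁, hmin⟩, c₂, hc₂, hharn⟩ := hCV
  have h : M.IsOptional (limitBoundary A) := hA.isOptional_limit
  have hxs : ∀ s, x ∉ A s := fun s hs => hx (hA.antitone (show (0 : ℝ≥0) ≤ s from zero_le) hs)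
  have hx_lim : x ∉ limitSet A := fun hs => hx (limitSet_subset A 0 hs)
  have hc₂' : (0 : ℝ) < c₂ := hc₂
  -- Any positive time would do to separate weak from strict survival; 1 belongs to both time sets.
  set e : I := ⟨1, hI.one_mem⟩ with he_def
  have he : 0 < e := show (0 : ℝ≥0) < 1 from one_pos
  have hpos : ∀ t, 0 < ∫ z, (killedOp h t 1).1 z ∂ν := fun t => by
    refine lt_of_lt_of_le (mul_pos hc₂' ?_) (mul_survive_le_integral h (hharn x hx_lim t))
    exact (real_survive_pos hA 0 t hx).trans_le
      (measureReal_mono (survive_mono_set (limitBoundary_subset A 0) t))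
  obtain ⟨t₁, het₁, c, hcpos, hminor⟩ := exists_minor hI h hc₁ hmin hpos e he
  have ht₁ : 0 < t₁ := he.trans_le het₁
  have hadd : ∀ r u f, killedOp h (r + u) f = killedOp h r (killedOp h u f) :=
    fun r u f => killedOp_add hI h h r u rfl f
  have hone : ∀ r y, (killedOp h r 1).1 y ≤ 1 := fun r y => by
    rw [killedOp_one]; exact measureReal_le_one
  have hanti : ∀ r u y, (killedOp h (r + u) 1).1 y ≤ (killedOp h r 1).1 y := fun r u y => by
    rw [killedOp_one, killedOp_one]
    exact measureReal_mono fun ω hω => le_trans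
      (ENNReal.coe_le_coe.2 (KilledPair.le_add_right' r u)) hω
  have hνmono : ∀ {f g : boundedMeasurable E}, (∀ y, f.1 y ≤ g.1 y) →
      ∫ z, f.1 z ∂ν ≤ ∫ z, g.1 z ∂ν := fun {f g} hfg =>
    integral_mono (integrable_comp f ν measurable_id) (integrable_comp g ν measurable_id) hfg
  set β := ∫ z, (killedOp h t₁ 1).1 z ∂ν with hβ
  have hβ0 : 0 < β := hpos t₁
  -- The first entry serves `t ≥ e`, through `hlong`. The second serves `t ≤ e`, including `t = 0`,
  -- where `q_t ≤ 1` and `ν(q_t) ≥ ν(q_e)`.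
  set K := max (1 / (c₂ * (c * β))) (1 / ∫ z, (killedOp h e 1).1 z ∂ν) with hK
  have hlong : ∀ t y, c₂ * (c * β) * (killedOp h (t + e) 1).1 y ≤
      ∫ z, (killedOp h (t + e) 1).1 z ∂ν := fun t y => by
    have h1 : c₂ * (killedOp h (t + e) 1).1 y ≤ ∫ z, (killedOp h t 1).1 z ∂ν := by
      by_cases hy : y ∈ limitSet A
      · rw [killedOp_limit_eq_zero h (he.trans_le (KilledPair.le_add_left' _ _)) hy, mul_zero]
        exact (hpos t).le
      refine le_trans ?_ (mul_survive_le_integral h (hharn y hy t))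
      rw [killedOp_one]
      exact mul_le_mul_of_nonneg_left
        (measureReal_mono (alive_subset_survive _ (lt_add_of_pos_right t he))) hc₂'.le
    obtain ⟨d, hd⟩ := hI.exists_add _ _ het₁
    have h2 : c * β * ∫ z, (killedOp h t 1).1 z ∂ν ≤ ∫ z, (killedOp h (t + e) 1).1 z ∂ν := by
      have h3 := hνmono (f := (c * ∫ z, (killedOp h t 1).1 z ∂ν) • killedOp h t₁ 1)
        (g := killedOp h t₁ (killedOp h t 1)) (fun z => by
          have := hminor (killedOp h t 1) (killedOp_nonneg h t 1 fun _ => zero_le_one) z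
          change c * _ * (killedOp h t₁ 1).1 z ≤ _
          linarith)
      have h4 : ∫ z, ((c * ∫ z, (killedOp h t 1).1 z ∂ν) • killedOp h t₁ 1).1 z ∂ν =
          (c * ∫ z, (killedOp h t 1).1 z ∂ν) * β := integral_const_mul _ _
      rw [h4, ← hadd] at h3
      refine le_trans (by linarith) (h3.trans (hνmono fun z => ?_))
      rw [show t₁ + t = t + e + d by rw [hd]; abel]
      exact hanti _ _ z
    calc _ = c * β * (c₂ * (killedOp h (t + e) 1).1 y) := by ring
      _ ≤ c * β * ∫ z, (killedOp h t 1).1 z ∂ν := by gcongr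
      _ ≤ _ := h2
  let νfun : boundedMeasurable E →ₗ[ℝ] ℝ :=
    { toFun := fun f => ∫ z, f.1 z ∂ν
      map_add' := fun f g =>
        integral_add (integrable_comp f ν measurable_id) (integrable_comp g ν measurable_id)
      map_smul' := fun a f => integral_const_mul a _ }
  refine ⟨{ Q := killedOp h
            R := fun s => killedOp (hA.isOptional_shifted s)
            ν := νfun
            x := x
            t₁ := t₁
            c := c
            K := K
            R_nonneg := fun s r f hf y => killedOp_nonneg _ r f hf y
            R_le := fun s r f hf y => killedOp_le _ _ (limitBoundary_subset A s) r f hf y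
            Q_add := hadd
            R_add := fun s r u f => killedOp_add hI _ _ r u (shifted_shifted A s r) f
            exists_add := hI.exists_add
            Q_zero := killedOp_zero _
            R_zero := fun s => killedOp_zero _
            Q_one_le := hone
            ν_nonneg := fun f hf => integral_nonneg hf
            ν_one := ?_
            t₁_pos := ht₁
            c_pos := hcpos
            minor := hminor
            harnack := fun t y => ?_
            R_pos := fun s r => ?_
            conv := fun V δ hδ => ?_ }, rfl, fun s => rfl, rfl⟩
  · change ∫ _, (1 : ℝ) ∂ν = 1
    simp
  · change _ ≤ K * ∫ z, (killedOp h t 1).1 z ∂ν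
    rcases le_total e t with het | het
    · obtain ⟨d, rfl⟩ := hI.exists_add _ _ het
      calc (killedOp h (d + e) 1).1 y
          = 1 / (c₂ * (c * β)) * (c₂ * (c * β) * (killedOp h (d + e) 1).1 y) := by field_simp
        _ ≤ _ := mul_le_mul (le_max_left _ _) (hlong d y)
            (mul_nonneg (by positivity) (killedOp_nonneg h _ 1 (fun _ => zero_le_one) y))
            (le_trans (by positivity) (le_max_left _ _))
    · obtain ⟨d, hd⟩ := hI.exists_add _ _ het
      have hpe := hpos e
      calc (killedOp h t 1).1 y ≤ 1 := hone t y
        _ = 1 / (∫ z, (killedOp h e 1).1 z ∂ν) * ∫ z, (killedOp h e 1).1 z ∂ν := by field_simp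
        _ ≤ _ := mul_le_mul (le_max_right _ _)
            (hνmono fun z => by rw [hd, add_comm d t]; exact hanti t d z) hpe.le
            (le_trans (by positivity) (le_max_left _ _))
  · rw [killedOp_one]
    exact (real_survive_pos hA s r (hxs s)).trans_le (measureReal_mono (survive_subset_alive _ r))
  · simp only [killedOp_one]
    exact hReg.eventually_alive_sub_le hI hA hx V hδ

/-! ### Conditioned laws as quotients, and the conclusion. -/

lemma condLaw_real (B : I → Set E) (x : E) (t u : I) {b : Set E} (hb : MeasurableSet b) :
    (M.condLaw B x t u).real b =
      (M.P x).real (M.survive B u ∩ M.X t ⁻¹' b) / (M.P x).real (M.survive B u) := by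
  rw [condLaw, map_measureReal_apply (M.measurable_X t) hb, ProbabilityTheory.cond,
    measureReal_ennreal_smul_apply, measureReal_restrict_apply (M.measurable_X t hb),
    ENNReal.toReal_inv, Set.inter_comm, div_eq_inv_mul]
  rfl

/-- Needed for `t + T = 0`, which the exchange of strict and weak survival excludes; both laws are
then the Dirac mass at `x`. -/
lemma condLaw_real_zero (B : I → Set E) (x : E) (u : I) {b : Set E} (hb : MeasurableSet b)
    (hpos : 0 < (M.P x).real (M.survive B u)) :
    (M.condLaw B x 0 u).real b = b.indicator 1 x := by
  rw [condLaw_real B x 0 u hb]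
  by_cases hx : x ∈ b
  · rw [measureReal_congr (t := M.survive B u), div_self hpos.ne', Set.indicator_of_mem hx,
      Pi.one_apply]
    filter_upwards [M.start x] with ω hω
    refine propext ⟨fun h => h.1, fun h => ⟨h, ?_⟩⟩
    change M.X 0 ω ∈ b
    rwa [hω]
  · rw [Set.indicator_of_notMem hx, div_eq_zero_iff, measureReal_eq_zero_iff]
    refine Or.inl (measure_mono_null ?_ (ae_iff.1 (M.start x)))
    rintro ω ⟨-, hω⟩ h0
    exact hx (h0 ▸ hω)

lemma real_survive_inter_eq (hI : I = ⊤) {B : I → Set E} {x : E}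
    (hc : Continuous fun t : I => (M.P x).real (M.survive B t))
    (hm : AEMeasurable (M.hit B) (M.P x)) {v : I} (hv : 0 < v) (b : Set Ω) :
    (M.P x).real (M.survive B v ∩ b) = (M.P x).real (M.alive B v ∩ b) := by
  refine measureReal_congr (ae_eq_set_inter ?_ EventuallyEq.rfl)
  refine ae_eq_of_subset_of_measure_ge (survive_subset_alive B v) ?_
    (hm.nullMeasurable measurableSet_Ioi) (measure_ne_top _ _)
  have := real_alive_eq_real_survive hI hc hv
  exact ((ENNReal.toReal_eq_toReal_iff' (measure_ne_top _ _) (measure_ne_top _ _)).1 this).le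

/-- Conditioning on `τ > t + T` is the same as conditioning on `τ ≥ t + T'`, with `T' = T` in
continuous time and `T' = T + 1` in discrete time. -/
lemma Regularity.exists_alive [TopologicalSpace E] (hReg : Regularity M A) (hI : IsTimeSet I)
    {x : E} (hx : x ∉ A 0) {t T : I} (h : 0 < t + T) : ∃ T' : I, ∀ b : Set Ω,
      (∀ s, (M.P x).real (M.survive (shifted A s) (t + T) ∩ b) =
        (M.P x).real (M.alive (shifted A s) (t + T') ∩ b)) ∧
      (M.P x).real (M.survive (limitBoundary A) (t + T) ∩ b) =
        (M.P x).real (M.alive (limitBoundary A) (t + T') ∩ b) := by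
  rcases hI with rfl | hI
  · refine ⟨T + ⟨1, 1, Nat.cast_one⟩, fun b => ?_⟩
    simp only [survive_eq_alive_add_one, add_assoc, implies_true, and_self]
  · have hd := hReg.tendsto_hit x hx
    exact ⟨T, fun b => ⟨fun s => real_survive_inter_eq hI (hReg.continuous_time x hx s)
      (hd.forall_aemeasurable s) h b, real_survive_inter_eq hI
      (hReg.continuous_time_limit x hx) hd.aemeasurable_limit h b⟩⟩

lemma eventually_condLaw_sub_le [TopologicalSpace E] (hI : IsTimeSet I) (hA : Standing M A)
    (hReg : Regularity M A) (hCV : LimitCV M A) {x : E} (hx : x ∉ A 0) {δ : ℝ} (hδ : 0 < δ)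
    (hδ1 : δ ≤ 1 / 2) : ∀ᶠ s in atTop, ∀ (t T : I) (b : Set E), MeasurableSet b →
      |(M.condLaw (shifted A s) x t (t + T)).real b -
        (M.condLaw (limitBoundary A) x t (t + T)).real b| ≤ 5 * δ := by
  obtain ⟨D, hDx, hDR, hDQ⟩ := exists_killedPair hI hA hReg hCV hx
  filter_upwards [D.eventually_abs_sub_le hδ hδ1] with s hs t T b hb
  have hxs : x ∉ A s := fun h => hx (hA.antitone (show (0 : ℝ≥0) ≤ s from zero_le) h)
  rcases eq_or_ne (t + T) 0 with h0 | h0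
  · have ht : t = 0 := le_antisymm ((KilledPair.le_add_right' t T).trans h0.le)
      (show (0 : ℝ≥0) ≤ t from zero_le)
    have h1 := real_survive_pos hA s (t + T) hxs
    rw [ht, condLaw_real_zero _ x _ hb (ht ▸ h1), condLaw_real_zero _ x _ hb
      ((ht ▸ h1).trans_le (measureReal_mono (survive_mono_set (limitBoundary_subset A s) _))),
      sub_self, abs_zero]
    positivity
  have hpos : 0 < t + T :=
    show (0 : ℝ≥0) < (t + T : I) from pos_iff_ne_zero.2 fun h => h0 (Subtype.ext h)
  obtain ⟨T', hT'⟩ := hReg.exists_alive hI hx hpos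
  have huniv := hT' Set.univ
  simp only [Set.inter_univ] at huniv
  rw [condLaw_real _ x t _ hb, condLaw_real _ x t _ hb, (hT' _).1, (hT' _).2, huniv.1, huniv.2,
    real_alive_inter hI (hA.isOptional_shifted s) (hA.isOptional_shifted (s + t)) t T'
      (shifted_shifted A s t) hb x,
    real_alive_inter hI hA.isOptional_limit hA.isOptional_limit t T' rfl hb x,
    ← killedOp_one (hA.isOptional_shifted s), ← killedOp_one hA.isOptional_limit]
  have := hs t T' (indicatorOne hb) (fun y => Set.indicator_nonneg (fun _ _ => zero_le_one) y)
    (fun y => Set.indicator_le_self' (fun _ _ => zero_le_one) y)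
  simpa only [hDx, hDR, hDQ, KilledPair.q] using this

end MovingBoundary

theorem mainTheorem5 {I : AddSubmonoid ℝ≥0} (hI : MovingBoundary.IsTimeSet I)
    {E : Type*} [MeasurableSpace E] [TopologicalSpace E] {Ω : Type*} [MeasurableSpace Ω]
    (M : MovingBoundary.MarkovFamily I E Ω) (A : I → Set E)
    (hA : MovingBoundary.Standing M A)
    (hReg : MovingBoundary.Regularity M A)
    (hCV : MovingBoundary.LimitCV M A)
    (x : E) (hx : x ∉ A 0) :
    Tendsto
      (fun s : I => ⨆ (t : I) (T : I),
        MovingBoundary.tvDist (M.condLaw (MovingBoundary.shifted A s) x t (t + T))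
          (M.condLaw (MovingBoundary.limitBoundary A) x t (t + T)))
      atTop (𝓝 0) := by
  rw [ENNReal.tendsto_nhds_zero]
  intro ε hε
  -- Truncation at 1 keeps `η` finite and makes `δ = η / 10` at most `1 / 2`.
  set η : ℝ := (min ε 1).toReal with hη
  have hne : min ε 1 ≠ ∞ := ne_top_of_le_ne_top ENNReal.one_ne_top (min_le_right _ _)
  have hη0 : 0 < η := ENNReal.toReal_pos (lt_min hε one_pos).ne' hne
  have hη1 : η ≤ 1 := ENNReal.toReal_mono ENNReal.one_ne_top (min_le_right ε 1)
  filter_upwards [MovingBoundary.eventually_condLaw_sub_le hI hA hReg hCV hx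
    (δ := η / 10) (by positivity) (by linarith)] with s hs
  refine iSup₂_le fun t T => iSup₂_le fun b hb => ?_
  calc _ ≤ ENNReal.ofReal η := ENNReal.ofReal_le_ofReal ((hs t T b hb).trans (by linarith))
    _ = min ε 1 := ENNReal.ofReal_toReal hne
    _ ≤ ε := min_le_left _ _
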